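/- Let $P=\{p_0,\dots,p_{k-1}\}$ be a finite set of proposition letters and $C=\wp(P)$. A (pointed) transition system is a tuple $\mathbb T=\langle T,R,\sigma,s_I\rangle$ with $R\subseteq T^2$, $\sigma:T\to C$, $s_I\in T$, in which every set $R[s]=\{t\mid sRt\}$ is non-empty. *WMSO.* Formulas are $\varphi::=\Downarrow p\mid p\sqsubseteq q\mid R(p,q)\mid\neg\varphi\mid\varphi\vee\varphi\mid\exists p.\varphi$, where the free letters belong to $P$, bound letters are taken from a countably infinite supply, and no letter is both free and bound. With $\sigma^\flat(p)=\{s\mid p\in\sigma(s)\}$: $\Downarrow p$ means $\sigma^\flat(p)=\{s_I\}$; $p\sqsubseteq q$ means $\sigma^\flat(p)\subseteq\sigma^\flat(q)$; $R(p,q)$ means that every $s\in\sigma^\flat(p)$ has an $R$-successor in $\sigma^\flat(q)$; and $\exists p.\varphi$ means that $\mathbb T[p\mapsto X]\models\varphi$ for some *finite* $X\subseteq T$. *One-step language.* For a finite set $A$ of monadic predicates, $\mathrm{FOE}^\infty_1(A)$ is the set of sentences built from $a(x)$ ($a\in A$) and $x\approx y$ with $\neg,\vee,\exists x$, $\exists^\infty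 x$ (for infinitely many $x$) and $\forall^\infty x$ (for all but finitely many $x$), interpreted in structures $(D,V)$ with $D\neq\emptyset$ and $V:A\to\wp(D)$. A sentence $\varphi$ is *monotone* in $a$ if $(D,V)\models\varphi$ and $V(a)\subseteq E\subseteq D$ imply $(D,V[a\mapsto E])\models\varphi$. It is *continuous* in $a$ if it is monotone in $a$ and $(D,V)\models\varphi$ implies $(D,V[a\mapsto U])\models\varphi$ for some finite $U\subseteq V(a)$. It is *co-continuous* in $a$ if it is monotone in $a$ and $(D,V)\not\models\varphi$ implies $(D,V[a\mapsto D\setminus U])\not\models\varphi$ for some finite $U\subseteq D\setminus V(a)$. *Automata.* $\mathrm{Aut}_{cw}(\mathrm{FOE}^\infty_1)$ is the class of automata $\mathbb A=\langle A,\Delta,\Omega,a_I\rangle$ over $C$ with $A$ a finite set, $a_I\in A$, $\Omega:A\to\mathbb N$, and $\Delta:A\times C\to\mathrm{FOE}^\infty_1(A)$ such that every $\Delta(a,c)$ is monotone in every $b\in A$ and such that the following holds. Let $\preceq$ be the reflexive-transitive closure of the relation "$b$ occurs in $\Delta(a,c)$ for some $c\in C$" between $a$ and $b$; whenever $a\preceq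 b$ and $b\preceq a$, then $\Omega(a)=\Omega(b)$, and for every $c\in C$ the sentence $\Delta(a,c)$ is continuous in $b$ if $\Omega(a)$ is odd, and co-continuous in $b$ if $\Omega(a)$ is even. $\mathbb A$ *accepts* $\mathbb T$ if $\exists$ has a winning strategy from $(a_I,s_I)$ in the following two-player game. At $(a,s)\in A\times T$, of priority $\Omega(a)$, player $\exists$ chooses $V:A\to\wp(R[s])$ with $(R[s],V)\models\Delta(a,\sigma(s))$; at $V$, of priority $\max\Omega[A]$, player $\forall$ chooses $(b,t)$ with $t\in V(b)$. A player who is stuck loses, and an infinite match is won by $\exists$ iff the least priority that occurs infinitely often is even. **Theorem.** There is an effective procedure which, given (a finite presentation of) a finite set $P$ of letters and an automaton $\mathbb A\in\mathrm{Aut}_{cw}(\mathrm{FOE}^\infty_1)$ over $\wp(P)$, returns a WMSO-formula $\varphi$ over $P$ that is equivalent to $\mathbb A$: for every transition system $\mathbb T$ (in particular, for every leafless tree), $\mathbb A$ accepts $\mathbb T$ if and only if $\mathbb T\models\varphi$. -/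

import Mathlib

open Set Filter

universe u

/-! ## The one-step language: monadic first-order logic with equality and the quantifiers
"there are infinitely many" and "all but finitely many" -/

/-- One-step formulas over a set `A` of monadic predicates; individual variables are numbers. -/
inductive OneStep (A : Type) : Type
  | pred (a : A) (x : ℕ)
  | eq (x y : ℕ)
  | neg (φ : OneStep A)
  | or (φ ψ : OneStep A)
  | ex (x : ℕ) (φ : OneStep A)
  | exInf (x : ℕ) (φ : OneStep A)
  | allInf (x : ℕ) (φ : OneStep A)

namespace OneStep

variable {A : Type}

/-- The free individual variables. -/
def free : OneStep A → Finset ℕ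
  | pred _ x => {x}
  | eq x y => {x, y}
  | neg φ => φ.free
  | or φ ψ => φ.free ∪ ψ.free
  | ex x φ => φ.free.erase x
  | exInf x φ => φ.free.erase x
  | allInf x φ => φ.free.erase x

/-- The monadic predicates that occur in a formula. -/
def occ : OneStep A → Set A
  | pred a _ => {a}
  | eq _ _ => ∅
  | neg φ => φ.occ
  | or φ ψ => φ.occ ∪ ψ.occ
  | ex _ φ => φ.occ
  | exInf _ φ => φ.occ
  | allInf _ φ => φ.occ

/-- Truth of a formula in the structure `(D, V)` under the assignment `g`. -/
def Sat {D : Type u} (V : A → Set D) : (ℕ → D) → OneStep A → Prop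
  | g, pred a x => g x ∈ V a
  | g, eq x y => g x = g y
  | g, neg φ => ¬ Sat V g φ
  | g, or φ ψ => Sat V g φ ∨ Sat V g ψ
  | g, ex x φ => ∃ d : D, Sat V (Function.update g x d) φ
  | g, exInf x φ => {d : D | Sat V (Function.update g x d) φ}.Infinite
  | g, allInf x φ => {d : D | ¬ Sat V (Function.update g x d) φ}.Finite

/-- Truth of a sentence in the structure `(D, V)`, for a non-empty domain `D` (where the choice
of the assignment is immaterial). -/
def Models {D : Type u} (V : A → Set D) (φ : OneStep A) : Prop :=
  ∀ g : ℕ → D, Sat V g φ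

/-- `φ` is monotone in the predicate `a`. -/
def MonotoneIn [DecidableEq A] (φ : OneStep A) (a : A) : Prop :=
  ∀ (D : Type u) (V : A → Set D) (g : ℕ → D) (E : Set D),
    Sat V g φ → V a ⊆ E → Sat (Function.update V a E) g φ

/-- `φ` is continuous in the predicate `a`. -/
def ContinuousIn [DecidableEq A] (φ : OneStep A) (a : A) : Prop :=
  MonotoneIn.{u} φ a ∧
    ∀ (D : Type u) (V : A → Set D) (g : ℕ → D), Sat V g φ →
      ∃ U : Set D, U.Finite ∧ U ⊆ V a ∧ Sat (Function.update V a U) g φ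

/-- `φ` is co-continuous in the predicate `a`. -/
def CoContinuousIn [DecidableEq A] (φ : OneStep A) (a : A) : Prop :=
  MonotoneIn.{u} φ a ∧
    ∀ (D : Type u) (V : A → Set D) (g : ℕ → D), ¬ Sat V g φ →
      ∃ U : Set D, U.Finite ∧ U ⊆ (V a)ᶜ ∧ ¬ Sat (Function.update V a Uᶜ) g φ

/-- Gödel numbers of one-step formulas. -/
def code {n : ℕ} : OneStep (Fin n) → ℕ
  | pred a x => Nat.pair 0 (Nat.pair a x)
  | eq x y => Nat.pair 1 (Nat.pair x y)
  | neg φ => Nat.pair 2 φ.code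
  | or φ ψ => Nat.pair 3 (Nat.pair φ.code ψ.code)
  | ex x φ => Nat.pair 4 (Nat.pair x φ.code)
  | exInf x φ => Nat.pair 5 (Nat.pair x φ.code)
  | allInf x φ => Nat.pair 6 (Nat.pair x φ.code)

end OneStep

theorem OneStep.code_injective {n : ℕ} : Function.Injective (OneStep.code (n := n)) := by
  intro φ
  induction φ with
  | pred a x => intro ψ h; cases ψ <;> simp [OneStep.code, Nat.pair_eq_pair, Fin.ext_iff] at h ⊢
                exact h
  | eq x y => intro ψ h; cases ψ <;> simp [OneStep.code, Nat.pair_eq_pair] at h ⊢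
              exact h
  | neg φ ih =>
    intro ψ h; cases ψ <;> simp [OneStep.code, Nat.pair_eq_pair] at h ⊢
    exact ih h
  | or φ ψ ih ih2 =>
    intro χ h; cases χ <;> simp [OneStep.code, Nat.pair_eq_pair] at h ⊢
    exact ⟨ih h.1, ih2 h.2⟩
  | ex x φ ih =>
    intro ψ h; cases ψ <;> simp [OneStep.code, Nat.pair_eq_pair] at h ⊢
    exact ⟨h.1, ih h.2⟩
  | exInf x φ ih =>
    intro ψ h; cases ψ <;> simp [OneStep.code, Nat.pair_eq_pair] at h ⊢
    exact ⟨h.1, ih h.2⟩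
  | allInf x φ ih =>
    intro ψ h; cases ψ <;> simp [OneStep.code, Nat.pair_eq_pair] at h ⊢
    exact ⟨h.1, ih h.2⟩

/-! ## Labelled transition systems -/

/-- A labelled transition system with domain `T` over the `k` proposition letters
`0, …, k - 1`, in which every node has a successor. -/
structure LTS (k : ℕ) (T : Type u) where
  /-- the accessibility relation -/
  R : T → T → Prop
  /-- the marking -/
  σ : T → Finset (Fin k)
  /-- the distinguished node -/
  root : T
  serial : ∀ s, ∃ t, R s t

namespace LTS

variable {k : ℕ} {T : Type u}

/-- The marking as a valuation. Proposition letters are natural numbers; those that do not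
belong to the `k` letters of the system are true nowhere. -/
def val (M : LTS k T) (p : ℕ) : Set T :=
  {s | ∃ h : p < k, (⟨p, h⟩ : Fin k) ∈ M.σ s}

end LTS

/-! ## Weak monadic second-order logic -/

/-- The formulas `↓p`, `p ⊑ q`, `R(p,q)`, `¬φ`, `φ ∨ ψ`, `∃p.φ`; letters are numbers. -/
inductive WMSO : Type
  | here (p : ℕ)
  | sub (p q : ℕ)
  | rel (p q : ℕ)
  | neg (φ : WMSO)
  | or (φ ψ : WMSO)
  | ex (p : ℕ) (φ : WMSO)

namespace WMSO

/-- The letters that occur free. -/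
def free : WMSO → Finset ℕ
  | here p => {p}
  | sub p q => {p, q}
  | rel p q => {p, q}
  | neg φ => φ.free
  | or φ ψ => φ.free ∪ ψ.free
  | ex p φ => φ.free.erase p

/-- The letters that are bound by some quantifier. -/
def bound : WMSO → Finset ℕ
  | here _ => ∅
  | sub _ _ => ∅
  | rel _ _ => ∅
  | neg φ => φ.bound
  | or φ ψ => φ.bound ∪ ψ.bound
  | ex p φ => insert p φ.bound

/-- `φ` is a formula over the letters `0, …, k - 1`: its free letters are among these, and no
letter is both free and bound in `φ`. -/
def IsOver (k : ℕ) (φ : WMSO) : Prop :=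
  (∀ p ∈ φ.free, p < k) ∧ Disjoint φ.free φ.bound

/-- Truth under a valuation of the letters; quantifiers range over finite sets. -/
def Sat {T : Type u} (R : T → T → Prop) (root : T) : (ℕ → Set T) → WMSO → Prop
  | ν, here p => ν p = {root}
  | ν, sub p q => ν p ⊆ ν q
  | ν, rel p q => ∀ s ∈ ν p, ∃ t ∈ ν q, R s t
  | ν, neg φ => ¬ Sat R root ν φ
  | ν, or φ ψ => Sat R root ν φ ∨ Sat R root ν ψ
  | ν, ex p φ => ∃ X : Set T, X.Finite ∧ Sat R root (Function.update ν p X) φ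

/-- Truth of a formula in a transition system. -/
def TrueIn {k : ℕ} {T : Type u} (φ : WMSO) (M : LTS k T) : Prop :=
  Sat M.R M.root M.val φ

/-- Gödel numbers of formulas. -/
def code : WMSO → ℕ
  | here p => Nat.pair 0 p
  | sub p q => Nat.pair 1 (Nat.pair p q)
  | rel p q => Nat.pair 2 (Nat.pair p q)
  | neg φ => Nat.pair 3 φ.code
  | or φ ψ => Nat.pair 4 (Nat.pair φ.code ψ.code)
  | ex p φ => Nat.pair 5 (Nat.pair p φ.code)

end WMSO

theorem WMSO.code_injective : Function.Injective WMSO.code := by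
  intro φ
  induction φ with
  | here p => intro ψ h; cases ψ <;> simp [WMSO.code, Nat.pair_eq_pair] at h ⊢
              exact h
  | sub p q => intro ψ h; cases ψ <;> simp [WMSO.code, Nat.pair_eq_pair] at h ⊢
               exact h
  | rel p q => intro ψ h; cases ψ <;> simp [WMSO.code, Nat.pair_eq_pair] at h ⊢
               exact h
  | neg φ ih =>
    intro ψ h; cases ψ <;> simp [WMSO.code, Nat.pair_eq_pair] at h ⊢
    exact ih h
  | or φ ψ ih ih2 =>
    intro χ h; cases χ <;> simp [WMSO.code, Nat.pair_eq_pair] at h ⊢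
    exact ⟨ih h.1, ih2 h.2⟩
  | ex x φ ih =>
    intro ψ h; cases ψ <;> simp [WMSO.code, Nat.pair_eq_pair] at h ⊢
    exact ⟨h.1, ih h.2⟩

/-! ## Board games -/

/-- A board game between Éloise and Abelard: `eloise` is the set of positions of Éloise (all
others belong to Abelard), `E` the admissible moves, and `win` the set of those infinite
sequences of positions that Éloise wins. -/
structure BoardGame (G : Type u) where
  eloise : Set G
  E : G → G → Prop
  win : Set (ℕ → G)

namespace BoardGame

variable {G : Type u}

/-- The list `π 0, …, π n`. -/
def history (π : ℕ → G) (n : ℕ) : List G :=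
  (List.range (n + 1)).map π

/-- `π 0, …, π n` is a match that starts at `v` and is guided by the strategy `f` of Éloise
(a strategy suggests a move on the basis of the match played so far). -/
def Guided (𝒢 : BoardGame G) (f : List G → G) (v : G) (π : ℕ → G) (n : ℕ) : Prop :=
  π 0 = v ∧ ∀ i < n, 𝒢.E (π i) (π (i + 1)) ∧
    (π i ∈ 𝒢.eloise → π (i + 1) = f (history π i))

/-- `f` is a winning strategy for Éloise in the game initialized at `v`: its suggestions are
legitimate, Éloise never gets stuck, and she wins all infinite matches guided by `f`. -/
structure IsWinning (𝒢 : BoardGame G) (f : List G → G) (v : G) : Prop where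
  legitimate : ∀ π n, 𝒢.Guided f v π n → π n ∈ 𝒢.eloise → (∃ w, 𝒢.E (π n) w) →
    𝒢.E (π n) (f (history π n))
  not_stuck : ∀ π n, 𝒢.Guided f v π n → (∀ w, ¬ 𝒢.E (π n) w) → π n ∉ 𝒢.eloise
  infinite : ∀ π, (∀ n, 𝒢.Guided f v π n) → π ∈ 𝒢.win

/-- The parity condition: the least priority that occurs infinitely often is even. -/
def parityWin (Ω : G → ℕ) : Set (ℕ → G) :=
  {π | ∃ m, Even m ∧ (∃ᶠ i in atTop, Ω (π i) = m) ∧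
    ∀ m' < m, ¬ ∃ᶠ i in atTop, Ω (π i) = m'}

end BoardGame

/-! ## Parity automata -/

/-- Parity automata over the alphabet of sets of the letters `0, …, k - 1`, with states
`0, …, n - 1`. Positivity of the transition map is imposed separately below. -/
structure ParityAutomaton (k : ℕ) where
  n : ℕ
  Δ : Fin n → Finset (Fin k) → OneStep (Fin n)
  sentence : ∀ a c, (Δ a c).free = ∅
  Ω : Fin n → ℕ
  start : Fin n

namespace ParityAutomaton

variable {k : ℕ}

/-- The acceptance game. At `(a, s)` Éloise turns the set of successors of `s` into a model of
`Δ(a, σ(s))` by choosing `V`, then Abelard chooses `(b, t)` with `t ∈ V b`. -/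
def game (𝔸 : ParityAutomaton k) {T : Type u} (M : LTS k T) :
    BoardGame ((Fin 𝔸.n × T) ⊕ (Fin 𝔸.n → Set T)) where
  eloise := Set.range Sum.inl
  E := fun
    | Sum.inl (a, s), Sum.inr V =>
        (∀ b, V b ⊆ {t | M.R s t}) ∧
          (𝔸.Δ a (M.σ s)).Models (fun b => {d : {t // M.R s t} | (d : T) ∈ V b})
    | Sum.inr V, Sum.inl (b, t) => t ∈ V b
    | _, _ => False
  win := BoardGame.parityWin (Sum.elim (fun q => 𝔸.Ω q.1) (fun _ => Finset.univ.sup 𝔸.Ω))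

/-- The automaton accepts the transition system. -/
def Accepts (𝔸 : ParityAutomaton k) {T : Type u} (M : LTS k T) : Prop :=
  ∃ f, (𝔸.game M).IsWinning f (Sum.inl (𝔸.start, M.root))

/-- Reachability: the reflexive-transitive closure of the relation that holds of `a` and `b`
when `b` occurs in `Δ(a, c)` for some colour `c`. -/
def Reach (𝔸 : ParityAutomaton k) : Fin 𝔸.n → Fin 𝔸.n → Prop :=
  Relation.ReflTransGen (fun a b => ∃ c, b ∈ (𝔸.Δ a c).occ)

/-- The class of continuous-weak parity automata. -/
structure IsContinuousWeak (𝔸 : ParityAutomaton k) : Prop where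
  /-- the transition map takes values in the positive fragment -/
  positive : ∀ a c b, (𝔸.Δ a c).MonotoneIn.{u} b
  weak : ∀ a b, 𝔸.Reach a b → 𝔸.Reach b a → 𝔸.Ω a = 𝔸.Ω b
  continuous : ∀ a b, 𝔸.Reach a b → 𝔸.Reach b a → Odd (𝔸.Ω a) →
    ∀ c, (𝔸.Δ a c).ContinuousIn.{u} b
  coContinuous : ∀ a b, 𝔸.Reach a b → 𝔸.Reach b a → Even (𝔸.Ω a) →
    ∀ c, (𝔸.Δ a c).CoContinuousIn.{u} b

/-- The colour with number `m < 2 ^ k`: the set of letters given by the binary digits of `m`. -/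
def colour (k m : ℕ) : Finset (Fin k) :=
  Finset.univ.filter (fun i => m.testBit i = true)

theorem colour_surjective (k : ℕ) (c : Finset (Fin k)) :
    ∃ m : Fin (2 ^ k), colour k m = c := by
  refine ⟨⟨Nat.ofBits (fun i => decide (i ∈ c)), Nat.ofBits_lt_two_pow _⟩, ?_⟩
  ext i
  simp [colour]

/-- The presentation of an automaton as a finite object, the input of an algorithm: the number
of letters, the number of states, the initial state, the list of priorities, and the table of
the Gödel numbers of the sentences `Δ(a, c)`, with one row for each state `a` and one column
for each colour `c`. -/
def code (𝔸 : ParityAutomaton k) : ℕ × ℕ × ℕ × List ℕ × List (List ℕ) :=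
  (k, 𝔸.n, 𝔸.start, List.ofFn 𝔸.Ω,
    List.ofFn fun a : Fin 𝔸.n => List.ofFn fun m : Fin (2 ^ k) => (𝔸.Δ a (colour k m)).code)

end ParityAutomaton

/-!
# From continuous-weak parity automata to weak monadic second-order logic

Fix an automaton in the class. Since priorities are constant on the clusters (the strongly
connected components of the occurrence relation between states), every infinite match of the
acceptance game whose states follow that relation ends up in one cluster and is won by Éloise if and
only if the priority of that cluster is even (`mem_win_iff`). Acceptance is therefore a fixpoint that is computed cluster by
cluster: on an odd cluster it is the least fixpoint of the one-step operator of the automaton, with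
the states below the cluster interpreted by what has been computed before; on an even cluster it is
the greatest fixpoint, whose complement is the least fixpoint of the dual operator. `clusterOp` is
the operator in both cases, and `level` iterates the computation along the height of the cluster
order. That the result is acceptance (`accepts_iff`) follows from a positional strategy on either
side: Éloise, where the computed relation holds, decreases in odd clusters the stage at which a
position enters the least fixpoint, and Abelard, where it fails, does so in even clusters.

Continuity on odd clusters and co-continuity on even ones say that `clusterOp` is finitary. For a
finitary operator `G`, a node `s` belongs to the least fixpoint if and only if there is a *finite*
set `X` with `s ∈ X` such that `s` belongs to all *finite* `Y` with `X ∩ G Y ⊆ Y`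
(`exists_mem_iterate_iff`): the finitely many nodes needed to derive `s` are collected in `X`. This
is expressible with quantifiers over finite sets. The one-step sentences are expressible as well,
individual variables being singletons, and finiteness of a set of successors being inclusion in
some finite set (`sat_translate`). No unravelling into a tree is needed, and the formulas of lower
clusters are plugged in as they are, the letter of the current node being rebound.

For effectivity, formulas are made into a `Primcodable` type with Gödel numbers as encoding, and all
constructions are recursions over Gödel numbers of the form `treeFold`, bounded quantifications (for
reachability), and operations on lists; hence the formula is a primitive recursive function of the
presentation of the automaton (`primrec_formula`).
-/

/-! ### One-step formulas -/

namespace OneStep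

variable {A : Type} {D : Type u}

theorem sat_congr_occ {φ : OneStep A} {V V' : A → Set D} (h : ∀ a ∈ φ.occ, V a = V' a)
    (g : ℕ → D) : Sat V g φ ↔ Sat V' g φ := by
  induction φ generalizing g with
  | pred a x => simp only [Sat, h a rfl]
  | eq x y => rfl
  | neg φ ih => simp only [Sat, ih h]
  | or φ ψ ih ih' =>
    simp only [Sat, ih fun a ha => h a (Or.inl ha), ih' fun a ha => h a (Or.inr ha)]
  | ex x φ ih => simp only [Sat, ih h]
  | exInf x φ ih => simp only [Sat, ih h]
  | allInf x φ ih => simp only [Sat, ih h]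

theorem sat_congr_free {φ : OneStep A} {V : A → Set D} {g g' : ℕ → D}
    (h : ∀ x ∈ φ.free, g x = g' x) : Sat V g φ ↔ Sat V g' φ := by
  have key : ∀ {φ : OneStep A} {x : ℕ} {g g' : ℕ → D} (d : D),
      (∀ y ∈ φ.free.erase x, g y = g' y) →
      ∀ y ∈ φ.free, Function.update g x d y = Function.update g' x d y := by
    intro φ x g g' d h y hy
    by_cases hyx : y = x
    · subst hyx; simp
    · simp only [Function.update_of_ne hyx]
      exact h y (Finset.mem_erase.2 ⟨hyx, hy⟩)
  induction φ generalizing g g' with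
  | pred a x => simp only [Sat, h x (by simp [free])]
  | eq x y => simp only [Sat, h x (by simp [free]), h y (by simp [free])]
  | neg φ ih => simp only [Sat, ih h]
  | or φ ψ ih ih' =>
    simp only [Sat, ih fun a ha => h a (Finset.mem_union_left _ ha),
      ih' fun a ha => h a (Finset.mem_union_right _ ha)]
  | ex x φ ih => exact exists_congr fun d => ih (key d h)
  | exInf x φ ih =>
    have : ∀ d, Sat V (Function.update g x d) φ ↔ Sat V (Function.update g' x d) φ :=
      fun d => ih (key d h)
    simp only [Sat, this]
  | allInf x φ ih =>
    have : ∀ d, Sat V (Function.update g x d) φ ↔ Sat V (Function.update g' x d) φ :=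
      fun d => ih (key d h)
    simp only [Sat, this]

theorem models_iff_sat {φ : OneStep A} (hφ : φ.free = ∅) (V : A → Set D) (g : ℕ → D) :
    φ.Models V ↔ Sat V g φ :=
  ⟨fun h => h g, fun h g' => (sat_congr_free (by simp [hφ])).1 h⟩

theorem sat_mono [Fintype A] [DecidableEq A] {φ : OneStep A} (hφ : ∀ a, MonotoneIn.{u} φ a)
    {V V' : A → Set D} (h : ∀ a ∈ φ.occ, V a ⊆ V' a) {g : ℕ → D} (hV : Sat V g φ) :
    Sat V' g φ := by
  classical
  -- the predicates are enlarged one at a time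
  have key : ∀ S : Finset A, Sat (fun a => if a ∈ S ∧ a ∈ φ.occ then V' a else V a) g φ := by
    intro S
    induction S using Finset.induction_on with
    | empty => simpa using hV
    | insert b S hb ih =>
      by_cases hbo : b ∈ φ.occ
      · convert hφ b D _ g (V' b) ih (by simpa [hb] using h b hbo) using 1
        ext a t
        by_cases hab : a = b
        · subst hab; simp [hbo]
        · simp [hab]
      · refine (sat_congr_occ (fun a ha => ?_) g).1 ih
        have hab : a ≠ b := fun e => hbo (e ▸ ha)
        simp [hab]
  refine (sat_congr_occ (fun a ha => ?_) g).1 (key Finset.univ)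
  simp [ha]

theorem exists_finite_of_continuousIn [DecidableEq A] {φ : OneStep A} (S : Finset A)
    (hφ : ∀ a ∈ S, ContinuousIn.{u} φ a) {V : A → Set D} {g : ℕ → D} (hV : Sat V g φ) :
    ∃ V' : A → Set D, (∀ a, V' a ⊆ V a) ∧ (∀ a ∈ S, (V' a).Finite) ∧
      (∀ a ∉ S, V' a = V a) ∧ Sat V' g φ := by
  induction S using Finset.induction_on with
  | empty => exact ⟨V, fun _ => Subset.rfl, by simp, fun _ _ => rfl, hV⟩
  | insert b S hb ih =>
    obtain ⟨V', h1, h2, h3, h4⟩ := ih fun a ha => hφ a (Finset.mem_insert_of_mem ha)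
    obtain ⟨U, hU, hUV, hs⟩ := (hφ b (Finset.mem_insert_self _ _)).2 D V' g h4
    refine ⟨Function.update V' b U, fun a => ?_, fun a ha => ?_, fun a ha => ?_, hs⟩
    · by_cases hab : a = b
      · subst hab; simpa using hUV.trans (h1 a)
      · simpa [Function.update_of_ne hab] using h1 a
    · by_cases hab : a = b
      · subst hab; simpa using hU
      · simpa [Function.update_of_ne hab] using h2 a (Finset.mem_of_mem_insert_of_ne ha hab)
    · rw [Finset.mem_insert, not_or] at ha
      rw [Function.update_of_ne ha.1, h3 a ha.2]

theorem exists_cofinite_of_coContinuousIn [DecidableEq A] {φ : OneStep A} (S : Finset A)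
    (hφ : ∀ a ∈ S, CoContinuousIn.{u} φ a) {V : A → Set D} {g : ℕ → D} (hV : ¬ Sat V g φ) :
    ∃ V' : A → Set D, (∀ a, V a ⊆ V' a) ∧ (∀ a ∈ S, (V' a)ᶜ.Finite) ∧
      (∀ a ∉ S, V' a = V a) ∧ ¬ Sat V' g φ := by
  induction S using Finset.induction_on with
  | empty => exact ⟨V, fun _ => Subset.rfl, by simp, fun _ _ => rfl, hV⟩
  | insert b S hb ih =>
    obtain ⟨V', h1, h2, h3, h4⟩ := ih fun a ha => hφ a (Finset.mem_insert_of_mem ha)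
    obtain ⟨U, hU, hUV, hs⟩ := (hφ b (Finset.mem_insert_self _ _)).2 D V' g h4
    refine ⟨Function.update V' b Uᶜ, fun a => ?_, fun a ha => ?_, fun a ha => ?_, hs⟩
    · by_cases hab : a = b
      · subst hab
        simpa using (h1 a).trans (subset_compl_comm.1 hUV)
      · simpa [Function.update_of_ne hab] using h1 a
    · by_cases hab : a = b
      · subst hab; simpa using hU
      · simpa [Function.update_of_ne hab] using h2 a (Finset.mem_of_mem_insert_of_ne ha hab)
    · rw [Finset.mem_insert, not_or] at ha
      rw [Function.update_of_ne ha.1, h3 a ha.2]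

end OneStep

/-! ### Least fixpoints of finitary operators -/

section Finitary

variable {ι : Type*} {T : Type u}

/-- A monotone operator on families of sets is finitary if membership in its values depends on
finite subfamilies only. -/
def IsFinitary (G : (ι → Set T) → ι → Set T) : Prop :=
  ∀ Y a, ∀ s ∈ G Y a, ∃ Y' ≤ Y, (∀ b, (Y' b).Finite) ∧ s ∈ G Y' a

theorem iterate_bot_le_succ {G : (ι → Set T) → ι → Set T} (hG : Monotone G) (j : ℕ) :
    G^[j] ⊥ ≤ G^[j + 1] ⊥ := by
  rw [Function.iterate_succ_apply]
  exact hG.iterate j bot_le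

/-- The union of the finite approximants is closed under a finitary operator. -/
theorem exists_mem_iterate_of_mem [Finite ι] {G : (ι → Set T) → ι → Set T} (hG : Monotone G)
    (hfin : IsFinitary G) {Y : ι → Set T} (hY : ∀ b, ∀ t ∈ Y b, ∃ j, t ∈ G^[j] ⊥ b) {a : ι}
    {s : T} (hs : s ∈ G Y a) : ∃ j, s ∈ G^[j] ⊥ a := by
  obtain ⟨Y', hY', hYf, hs⟩ := hfin _ _ _ hs
  have := fun b => (hYf b).to_subtype
  choose j hj using fun p : (Σ b, Y' b) => hY p.1 p.2 (hY' _ p.2.2)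
  obtain ⟨J, hJ⟩ := Finite.exists_le j
  refine ⟨J + 1, ?_⟩
  rw [Function.iterate_succ_apply']
  refine hG (fun c r hr => ?_) a hs
  exact monotone_nat_of_le_succ (iterate_bot_le_succ hG) (hJ ⟨c, r, hr⟩) c (hj ⟨c, r, hr⟩)

/-- The least fixpoint of a finitary operator `G`, given here as the union of its finite
approximants, is described by quantification over finite sets only: it is the union, over the
finite sets `X`, of the least fixpoints of the relativizations of `G` to `X`. -/
theorem exists_mem_iterate_iff [Finite ι] {G : (ι → Set T) → ι → Set T} (hG : Monotone G)
    (hfin : IsFinitary G) (a : ι) (s : T) :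
    (∃ j, s ∈ G^[j] ⊥ a) ↔ ∃ X : Set T, X.Finite ∧ s ∈ X ∧ ∀ Y : ι → Set T,
      (∀ b, (Y b).Finite) → (∀ b, ∀ t ∈ X, t ∈ G Y b → t ∈ Y b) → s ∈ Y a := by
  constructor
  · rintro ⟨j, hj⟩
    induction j generalizing a s with
    | zero => exact absurd hj (notMem_empty s)
    | succ j ih =>
      rw [Function.iterate_succ_apply'] at hj
      obtain ⟨Y', hY', hYf, hs⟩ := hfin _ _ _ hj
      -- `X` collects `s` and the finite sets that witness its finitely many premises
      choose X hX using fun (b : ι) (t : Y' b) => ih b t (hY' b t.2)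
      have := fun b => (hYf b).to_subtype
      refine ⟨{s} ∪ ⋃ b, ⋃ t, X b t,
        (finite_singleton s).union (finite_iUnion fun b => finite_iUnion fun t => (hX b t).1),
        Or.inl rfl, fun Y hY hclosed => ?_⟩
      refine hclosed a s (Or.inl rfl) (hG (fun b t ht => ?_) a hs)
      refine (hX b ⟨t, ht⟩).2.2 Y hY fun c r hr => hclosed c r (Or.inr ?_)
      exact mem_iUnion.2 ⟨b, mem_iUnion.2 ⟨⟨t, ht⟩, hr⟩⟩
  · rintro ⟨X, hX, hsX, h⟩
    -- the least fixpoint, cut down to `X`, is one of the finite families `Y`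
    let Y : ι → Set T := fun b => {t | t ∈ X ∧ ∃ j, t ∈ G^[j] ⊥ b}
    exact (h Y (fun b => hX.subset fun t ht => ht.1) fun b t htX ht =>
      ⟨htX, exists_mem_iterate_of_mem hG hfin (fun c r hr => hr.2) ht⟩).2

end Finitary

/-! ### Clusters of states and the approximation of acceptance -/

namespace ParityAutomaton

variable {k : ℕ} (𝔸 : ParityAutomaton k) {T : Type u} (M : LTS k T)

/-- The truth of the one-step sentence of the state `a` at the node `s`, for a valuation `V` of
the states in the whole transition system. -/
def Step (a : Fin 𝔸.n) (V : Fin 𝔸.n → Set T) (s : T) : Prop :=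
  (𝔸.Δ a (M.σ s)).Models (fun b => {d : {t // M.R s t} | (d : T) ∈ V b})

/-- `a` and `b` are reachable from each other. -/
def SameCluster (a b : Fin 𝔸.n) : Prop := 𝔸.Reach a b ∧ 𝔸.Reach b a

open Classical in
/-- The valuation that is `Y` on the cluster of `a` and `W` elsewhere. -/
noncomputable def hybrid (a : Fin 𝔸.n) (Y W : Fin 𝔸.n → Set T) (b : Fin 𝔸.n) : Set T :=
  if 𝔸.SameCluster a b then Y b else W b

/-- The operator whose least fixpoint, for an odd cluster, is the acceptance relation on the
cluster of `a`, and for an even cluster is the complement of it; `W` is the acceptance relation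
outside of the cluster. It is empty outside of the cluster. -/
def clusterOp (a : Fin 𝔸.n) (W Y : Fin 𝔸.n → Set T) (b : Fin 𝔸.n) : Set T :=
  {s | 𝔸.SameCluster a b ∧ (Odd (𝔸.Ω a) → 𝔸.Step M b (𝔸.hybrid a Y W) s) ∧
    (Even (𝔸.Ω a) → ¬ 𝔸.Step M b (𝔸.hybrid a (fun c => (Y c)ᶜ) W) s)}

open Classical in
/-- The value at `a` that is obtained from the values `W` at the states below the cluster. -/
noncomputable def clusterSem (W : Fin 𝔸.n → Set T) (a : Fin 𝔸.n) : Set T :=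
  if Odd (𝔸.Ω a) then {s | ∃ j, s ∈ (𝔸.clusterOp M a W)^[j] ⊥ a}
  else {s | ∃ j, s ∈ (𝔸.clusterOp M a W)^[j] ⊥ a}ᶜ

/-- Acceptance, computed correctly at the states from which at most `d` states are reachable. -/
noncomputable def level : ℕ → Fin 𝔸.n → Set T
  | 0 => fun _ => univ
  | d + 1 => 𝔸.clusterSem M (level d)

/-- The number of states that are reachable from `a`. -/
noncomputable def height (a : Fin 𝔸.n) : ℕ := {b | 𝔸.Reach a b}.ncard

variable {𝔸 M}

theorem SameCluster.refl (a : Fin 𝔸.n) : 𝔸.SameCluster a a :=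
  ⟨Relation.ReflTransGen.refl, Relation.ReflTransGen.refl⟩

theorem SameCluster.symm {a b : Fin 𝔸.n} (h : 𝔸.SameCluster a b) : 𝔸.SameCluster b a :=
  ⟨h.2, h.1⟩

theorem SameCluster.trans {a b c : Fin 𝔸.n} (h : 𝔸.SameCluster a b) (h' : 𝔸.SameCluster b c) :
    𝔸.SameCluster a c :=
  ⟨h.1.trans h'.1, h'.2.trans h.2⟩

theorem height_lt_of_reach {a b : Fin 𝔸.n} (h : 𝔸.Reach a b) (h' : ¬ 𝔸.Reach b a) :
    𝔸.height b < 𝔸.height a :=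
  ncard_lt_ncard ⟨fun _ hc => h.trans hc, fun hs => h' (hs Relation.ReflTransGen.refl)⟩
    (toFinite _)

theorem height_le (a : Fin 𝔸.n) : 𝔸.height a ≤ 𝔸.n :=
  (ncard_le_ncard (subset_univ {b | 𝔸.Reach a b}) (toFinite _)).trans (by simp)

theorem height_pos (a : Fin 𝔸.n) : 0 < 𝔸.height a :=
  (ncard_pos (toFinite _)).2 ⟨a, Relation.ReflTransGen.refl⟩

theorem step_iff {a : Fin 𝔸.n} {V : Fin 𝔸.n → Set T} {s : T} (g : ℕ → {t // M.R s t}) :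
    𝔸.Step M a V s ↔
      (𝔸.Δ a (M.σ s)).Sat (fun b => {d : {t // M.R s t} | (d : T) ∈ V b}) g :=
  OneStep.models_iff_sat (𝔸.sentence _ _) _ g

theorem step_congr {a : Fin 𝔸.n} {V V' : Fin 𝔸.n → Set T} {s : T}
    (h : ∀ b ∈ (𝔸.Δ a (M.σ s)).occ, V b = V' b) : 𝔸.Step M a V s ↔ 𝔸.Step M a V' s :=
  forall_congr' fun g => OneStep.sat_congr_occ (fun b hb => by rw [h b hb]) g

theorem step_mono (h𝔸 : IsContinuousWeak.{u} 𝔸) {a : Fin 𝔸.n} {V V' : Fin 𝔸.n → Set T} {s : T}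
    (h : ∀ b ∈ (𝔸.Δ a (M.σ s)).occ, V b ∩ {t | M.R s t} ⊆ V' b) (hV : 𝔸.Step M a V s) :
    𝔸.Step M a V' s :=
  fun g => OneStep.sat_mono (h𝔸.positive a _) (fun b hb (d : {t // M.R s t}) hd => h b hb ⟨hd, d.2⟩) (hV g)

theorem hybrid_mono {a : Fin 𝔸.n} {Y Y' W : Fin 𝔸.n → Set T} (h : Y ≤ Y') :
    𝔸.hybrid a Y W ≤ 𝔸.hybrid a Y' W := by
  intro b
  simp only [hybrid]
  split_ifs
  exacts [h b, le_rfl]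

theorem clusterOp_mono (h𝔸 : IsContinuousWeak.{u} 𝔸) (a : Fin 𝔸.n) (W : Fin 𝔸.n → Set T) :
    Monotone (𝔸.clusterOp M a W) := by
  intro Y Y' h b s hs
  refine ⟨hs.1, fun ho => ?_, fun he hs' => hs.2.2 he ?_⟩
  · exact step_mono h𝔸 (fun c _ t ht => hybrid_mono h c ht.1) (hs.2.1 ho)
  · exact step_mono h𝔸
      (fun c _ t ht => hybrid_mono (fun c => compl_subset_compl.2 (h c)) c ht.1) hs'

theorem clusterOp_finitary (h𝔸 : IsContinuousWeak.{u} 𝔸) (a : Fin 𝔸.n)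
    (W : Fin 𝔸.n → Set T) : IsFinitary (𝔸.clusterOp M a W) := by
  classical
  intro Y b s hs
  obtain ⟨t₀, ht₀⟩ := M.serial s
  let g : ℕ → {t // M.R s t} := fun _ => ⟨t₀, ht₀⟩
  have hΩ := h𝔸.weak a b hs.1.1 hs.1.2
  let S : Finset (Fin 𝔸.n) := Finset.univ.filter fun c => 𝔸.SameCluster a c
  rcases Nat.even_or_odd (𝔸.Ω a) with he | ho
  · have hno : ¬ Odd (𝔸.Ω a) := Nat.not_odd_iff_even.2 he
    obtain ⟨V', h1, h2, h3, h4⟩ := OneStep.exists_cofinite_of_coContinuousIn S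
      (fun c hc => h𝔸.coContinuous b c
        (hs.1.symm.trans (by simpa [S] using hc)).1 (hs.1.symm.trans (by simpa [S] using hc)).2
        (hΩ ▸ he) (M.σ s)) ((step_iff g).not.1 (hs.2.2 he))
    -- `V'` is cofinite among the successors of `s`, and only these matter
    refine ⟨fun c => if 𝔸.SameCluster a c then Subtype.val '' (V' c)ᶜ else ∅,
      fun c => ?_, fun c => ?_, hs.1, fun ho => absurd ho hno, fun _ => (step_iff g).not.2 ?_⟩
    · by_cases hc : 𝔸.SameCluster a c
      · simp only [hc, if_true]
        rintro _ ⟨d, hd, rfl⟩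
        by_contra hdY
        exact hd (h1 c (by simpa [hybrid, hc] using hdY))
      · simp [hc]
    · by_cases hc : 𝔸.SameCluster a c
      · simpa [hc] using (h2 c (by simp [S, hc])).image Subtype.val
      · simp [hc]
    · convert h4 using 2
      ext c d
      by_cases hc : 𝔸.SameCluster a c
      · simp [hybrid, hc, d.2]
      · simp [hybrid, hc, h3 c (by simp [S, hc])]
  · have hne : ¬ Even (𝔸.Ω a) := Nat.not_even_iff_odd.2 ho
    obtain ⟨V', h1, h2, h3, h4⟩ := OneStep.exists_finite_of_continuousIn S
      (fun c hc => h𝔸.continuous b c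
        (hs.1.symm.trans (by simpa [S] using hc)).1 (hs.1.symm.trans (by simpa [S] using hc)).2
        (hΩ ▸ ho) (M.σ s)) ((step_iff g).1 (hs.2.1 ho))
    refine ⟨fun c => if 𝔸.SameCluster a c then Subtype.val '' V' c else ∅,
      fun c => ?_, fun c => ?_, hs.1, fun _ => (step_iff g).2 ?_, fun he => absurd he hne⟩
    · by_cases hc : 𝔸.SameCluster a c
      · simp only [hc, if_true]
        rintro _ ⟨d, hd, rfl⟩
        simpa [hybrid, hc] using h1 c hd
      · simp [hc]
    · by_cases hc : 𝔸.SameCluster a c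
      · simpa [hc] using (h2 c (by simp [S, hc])).image Subtype.val
      · simp [hc]
    · convert h4 using 1
      funext c
      ext d
      by_cases hc : 𝔸.SameCluster a c
      · simp [hybrid, hc, d.2]
      · simp [hybrid, hc, h3 c (by simp [S, hc])]

theorem reach_of_mem_occ {a b : Fin 𝔸.n} {c : Finset (Fin k)} (h : b ∈ (𝔸.Δ a c).occ) :
    𝔸.Reach a b :=
  Relation.ReflTransGen.single ⟨c, h⟩

/-- The operator of a cluster depends only on the states strictly below it. -/
theorem clusterOp_congr {a : Fin 𝔸.n} {W W' : Fin 𝔸.n → Set T}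
    (h : ∀ b, 𝔸.Reach a b → ¬ 𝔸.Reach b a → W b = W' b) :
    𝔸.clusterOp M a W = 𝔸.clusterOp M a W' := by
  have key : ∀ Y b, 𝔸.SameCluster a b → ∀ s,
      (𝔸.Step M b (𝔸.hybrid a Y W) s ↔ 𝔸.Step M b (𝔸.hybrid a Y W') s) := by
    intro Y b hb s
    refine step_congr fun c hc => ?_
    have hac : 𝔸.Reach a c := hb.1.trans (reach_of_mem_occ hc)
    by_cases hca : 𝔸.SameCluster a c
    · simp [hybrid, hca]
    · simp [hybrid, hca, h c hac fun h' => hca ⟨hac, h'⟩]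
  funext Y b
  ext s
  exact and_congr_right fun hb => by rw [key _ b hb, key _ b hb]

theorem clusterSem_congr {a : Fin 𝔸.n} {W W' : Fin 𝔸.n → Set T}
    (h : ∀ b, 𝔸.Reach a b → ¬ 𝔸.Reach b a → W b = W' b) :
    𝔸.clusterSem M W a = 𝔸.clusterSem M W' a := by
  simp only [clusterSem, clusterOp_congr h]

/-- The value at a state depends only on states of smaller height, so that it is stable from the
depth of its height on. -/
theorem level_eq_succ (d : ℕ) (a : Fin 𝔸.n) (h : 𝔸.height a ≤ d) :
    𝔸.level M d a = 𝔸.level M (d + 1) a := by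
  induction d generalizing a with
  | zero => exact absurd (height_pos a) (by omega)
  | succ d ih =>
    refine clusterSem_congr fun b hab hba => ih b ?_
    have := height_lt_of_reach hab hba
    omega

/-- At depth `n` the approximation is stable. -/
theorem level_eq_clusterSem :
    𝔸.level M 𝔸.n = 𝔸.clusterSem M (𝔸.level M 𝔸.n) :=
  funext fun a => level_eq_succ _ a (height_le a)

end ParityAutomaton

/-! ### Board games -/

namespace BoardGame

variable {G : Type u}

theorem history_succ (π : ℕ → G) (n : ℕ) : history π (n + 1) = history π n ++ [π (n + 1)] := by
  simp [history, List.range_succ]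

theorem getLast?_history (π : ℕ → G) (n : ℕ) : (history π n).getLast? = some (π n) := by
  cases n with
  | zero => simp [history]
  | succ n => simp [history_succ]

theorem dropLast_history_succ (π : ℕ → G) (n : ℕ) :
    (history π (n + 1)).dropLast = history π n := by
  simp [history_succ]

theorem Guided.mono {𝒢 : BoardGame G} {f : List G → G} {v : G} {π : ℕ → G} {n m : ℕ}
    (h : 𝒢.Guided f v π n) (hm : m ≤ n) : 𝒢.Guided f v π m :=
  ⟨h.1, fun i hi => h.2 i (by omega)⟩

/-- Every rule that continues matches produces an infinite sequence. -/
theorem exists_sequence (F : List G → G) (v : G) :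
    ∃ π : ℕ → G, π 0 = v ∧ ∀ n, π (n + 1) = F (history π n) := by
  let h : ℕ → List G := fun n => Nat.rec [v] (fun _ l => l ++ [F l]) n
  let π : ℕ → G := fun n => (h n).getLast?.getD v
  have hsucc : ∀ n, π (n + 1) = F (h n) := fun n => by simp [π, h]
  have hh : ∀ n, history π n = h n := by
    intro n
    induction n with
    | zero => simp [history, π, h]
    | succ n ih => rw [history_succ, ih, hsucc]
  exact ⟨π, by simp [π, h], fun n => by rw [hh, hsucc]⟩

end BoardGame

/-! ### The acceptance game -/

namespace ParityAutomaton

variable {k : ℕ} {𝔸 : ParityAutomaton k} {T : Type u} {M : LTS k T}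

variable (𝔸 M) in
/-- The stage at which `s` enters the least fixpoint of the cluster of `a`,
provided that it does so. -/
noncomputable def rank (W : Fin 𝔸.n → Set T) (a : Fin 𝔸.n) (s : T) : ℕ :=
  sInf {j | s ∈ (𝔸.clusterOp M a W)^[j] ⊥ a}

theorem clusterOp_eq_of_sameCluster (h𝔸 : IsContinuousWeak.{u} 𝔸) {a b : Fin 𝔸.n}
    (h : 𝔸.SameCluster a b) (W : Fin 𝔸.n → Set T) :
    𝔸.clusterOp M a W = 𝔸.clusterOp M b W := by
  have hab : ∀ c, 𝔸.SameCluster a c ↔ 𝔸.SameCluster b c :=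
    fun c => ⟨fun h' => h.symm.trans h', fun h' => h.trans h'⟩
  have hh : 𝔸.hybrid a = 𝔸.hybrid b (T := T) := by
    funext Y W c
    by_cases hc : 𝔸.SameCluster a c
    · simp [hybrid, hc, (hab c).1 hc]
    · simp [hybrid, hc, mt (hab c).2 hc]
  funext Y c
  simp only [clusterOp, hh, hab, h𝔸.weak a b h.1 h.2]

theorem mem_clusterSem_iff_of_odd {W : Fin 𝔸.n → Set T} {a : Fin 𝔸.n} (ha : Odd (𝔸.Ω a))
    {s : T} : s ∈ 𝔸.clusterSem M W a ↔ ∃ j, s ∈ (𝔸.clusterOp M a W)^[j] ⊥ a := by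
  simp [clusterSem, ha]

theorem mem_clusterSem_iff_of_even {W : Fin 𝔸.n → Set T} {a : Fin 𝔸.n} (ha : Even (𝔸.Ω a))
    {s : T} : s ∈ 𝔸.clusterSem M W a ↔ ¬ ∃ j, s ∈ (𝔸.clusterOp M a W)^[j] ⊥ a := by
  simp [clusterSem, Nat.not_odd_iff_even.2 ha]

/-- An element of the least fixpoint enters it because of elements of smaller rank. -/
theorem mem_clusterOp_rank_lt (h𝔸 : IsContinuousWeak.{u} 𝔸) {W : Fin 𝔸.n → Set T}
    {a : Fin 𝔸.n} {s : T} (h : ∃ j, s ∈ (𝔸.clusterOp M a W)^[j] ⊥ a) :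
    s ∈ 𝔸.clusterOp M a W (fun b => {t | 𝔸.SameCluster a b →
      (∃ j, t ∈ (𝔸.clusterOp M b W)^[j] ⊥ b) ∧ 𝔸.rank M W b t < 𝔸.rank M W a s}) a := by
  have hr : s ∈ (𝔸.clusterOp M a W)^[𝔸.rank M W a s] ⊥ a := Nat.sInf_mem h
  obtain ⟨j, hj⟩ : ∃ j, 𝔸.rank M W a s = j + 1 := by
    refine Nat.exists_eq_succ_of_ne_zero fun h0 => ?_
    rw [h0] at hr
    exact hr
  rw [hj, Function.iterate_succ_apply'] at hr
  rw [hj]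
  refine clusterOp_mono h𝔸 a W ?_ a hr
  intro b t ht hab
  rw [clusterOp_eq_of_sameCluster h𝔸 hab] at ht
  exact ⟨⟨j, ht⟩, Nat.lt_succ_of_le (Nat.sInf_le ht)⟩

/-- Where acceptance holds, Éloise can satisfy the one-step sentence within the acceptance
relation, and inside of an odd cluster with elements of smaller rank. -/
theorem step_of_mem (h𝔸 : IsContinuousWeak.{u} 𝔸) {W : Fin 𝔸.n → Set T}
    (hW : W = 𝔸.clusterSem M W) {a : Fin 𝔸.n} {s : T} (hs : s ∈ W a) :
    𝔸.Step M a (fun b => {t | t ∈ W b ∧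
      (Odd (𝔸.Ω a) → 𝔸.SameCluster a b → 𝔸.rank M W b t < 𝔸.rank M W a s)}) s := by
  rw [hW] at hs
  rcases Nat.even_or_odd (𝔸.Ω a) with he | ho
  · rw [mem_clusterSem_iff_of_even he] at hs
    have hno : ¬ Odd (𝔸.Ω a) := Nat.not_odd_iff_even.2 he
    -- otherwise `s` would have entered the least fixpoint of the dual operator
    by_contra hstep
    refine hs (exists_mem_iterate_of_mem (clusterOp_mono h𝔸 a W) (clusterOp_finitary h𝔸 a W)
      (Y := fun b => {t | ∃ j, t ∈ (𝔸.clusterOp M a W)^[j] ⊥ b}) (fun _ _ h => h)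
      ⟨SameCluster.refl a, fun ho => absurd ho hno, fun _ hstep' => hstep ?_⟩)
    refine step_mono h𝔸 (fun b _ t ht => ⟨?_, fun ho => absurd ho hno⟩) hstep'
    by_cases hab : 𝔸.SameCluster a b
    · rw [hW, mem_clusterSem_iff_of_even (h𝔸.weak a b hab.1 hab.2 ▸ he),
        ← clusterOp_eq_of_sameCluster h𝔸 hab]
      simpa [hybrid, hab] using ht.1
    · simpa [hybrid, hab] using ht.1
  · rw [mem_clusterSem_iff_of_odd ho] at hs
    refine step_mono h𝔸 (fun b _ t ht => ?_) ((mem_clusterOp_rank_lt h𝔸 hs).2.1 ho)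
    by_cases hab : 𝔸.SameCluster a b
    · have ht := ht.1
      simp only [hybrid, hab, if_true, mem_ofPred_eq, true_imp_iff] at ht
      refine ⟨?_, fun _ _ => ht.2⟩
      rw [hW, mem_clusterSem_iff_of_odd (h𝔸.weak a b hab.1 hab.2 ▸ ho)]
      exact ht.1
    · exact ⟨by simpa [hybrid, hab] using ht.1, fun _ h => absurd h hab⟩

/-- Where acceptance fails, every valuation that Éloise can choose leaves the acceptance
relation, and inside of an even cluster at an element of smaller rank. -/
theorem not_step_of_notMem (h𝔸 : IsContinuousWeak.{u} 𝔸) {W : Fin 𝔸.n → Set T}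
    (hW : W = 𝔸.clusterSem M W) {a : Fin 𝔸.n} {s : T} (hs : s ∉ W a) :
    ¬ 𝔸.Step M a (fun b => {t | t ∈ W b ∨
      (Even (𝔸.Ω a) ∧ 𝔸.SameCluster a b ∧ ¬ 𝔸.rank M W b t < 𝔸.rank M W a s)}) s := by
  rw [hW] at hs
  rcases Nat.even_or_odd (𝔸.Ω a) with he | ho
  · rw [mem_clusterSem_iff_of_even he, not_not] at hs
    intro hstep
    refine (mem_clusterOp_rank_lt h𝔸 hs).2.2 he (step_mono h𝔸 (fun b _ t ht => ?_) hstep)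
    by_cases hab : 𝔸.SameCluster a b
    · simp only [hybrid, hab, if_true, mem_compl_iff, mem_ofPred_eq, true_imp_iff]
      rintro ⟨hj, hlt⟩
      rcases ht.1 with ht | ht
      · rw [hW, mem_clusterSem_iff_of_even (h𝔸.weak a b hab.1 hab.2 ▸ he)] at ht
        exact ht hj
      · exact ht.2.2 hlt
    · have ht := ht.1
      simpa [hybrid, hab] using ht
  · rw [mem_clusterSem_iff_of_odd ho] at hs
    have hne : ¬ Even (𝔸.Ω a) := Nat.not_even_iff_odd.2 ho
    intro hstep
    refine hs (exists_mem_iterate_of_mem (clusterOp_mono h𝔸 a W) (clusterOp_finitary h𝔸 a W)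
      (Y := fun b => {t | ∃ j, t ∈ (𝔸.clusterOp M a W)^[j] ⊥ b}) (fun _ _ h => h)
      ⟨SameCluster.refl a, fun _ => ?_, fun he => absurd he hne⟩)
    refine step_mono h𝔸 (fun b _ t ht => ?_) hstep
    have ht' : t ∈ W b := ht.1.resolve_right fun h => hne h.1
    by_cases hab : 𝔸.SameCluster a b
    · rw [hW, mem_clusterSem_iff_of_odd (h𝔸.weak a b hab.1 hab.2 ▸ ho),
        ← clusterOp_eq_of_sameCluster h𝔸 hab] at ht'
      simpa [hybrid, hab] using ht'
    · simpa [hybrid, hab] using ht'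

/-- A path of states ends up in a single cluster. -/
theorem exists_sameCluster (a : ℕ → Fin 𝔸.n) (h : ∀ i, 𝔸.Reach (a i) (a (i + 1))) :
    ∃ N, ∀ i ≥ N, 𝔸.SameCluster (a N) (a i) := by
  obtain ⟨_, ⟨N, rfl⟩, hN⟩ :=
    WellFounded.has_min (wellFounded_lt (α := ℕ)) (range fun i => 𝔸.height (a i)) ⟨_, 0, rfl⟩
  refine ⟨N, fun i hi => ?_⟩
  have hreach : 𝔸.Reach (a N) (a i) := by
    induction i, hi using Nat.le_induction with
    | base => exact Relation.ReflTransGen.refl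
    | succ i _ ih => exact ih.trans (h i)
  refine ⟨hreach, by_contra fun h' => hN _ ⟨i, rfl⟩ (height_lt_of_reach hreach h')⟩

/-- The winner of an infinite match is determined by the parity of its final cluster. -/
theorem mem_win_iff (h𝔸 : IsContinuousWeak.{u} 𝔸) {a : ℕ → Fin 𝔸.n} {s : ℕ → T}
    {V : ℕ → Fin 𝔸.n → Set T} {π : ℕ → (Fin 𝔸.n × T) ⊕ (Fin 𝔸.n → Set T)}
    (h0 : ∀ i, π (2 * i) = Sum.inl (a i, s i)) (h1 : ∀ i, π (2 * i + 1) = Sum.inr (V i))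
    {N : ℕ} (hN : ∀ i ≥ N, 𝔸.SameCluster (a N) (a i)) :
    π ∈ (𝔸.game M).win ↔ Even (𝔸.Ω (a N)) := by
  set Ω' : (Fin 𝔸.n × T) ⊕ (Fin 𝔸.n → Set T) → ℕ :=
    Sum.elim (fun q => 𝔸.Ω q.1) (fun _ => Finset.univ.sup 𝔸.Ω) with hΩ'
  have hwin : (𝔸.game M).win = BoardGame.parityWin Ω' := rfl
  set p := 𝔸.Ω (a N) with hp
  have hge : ∀ i ≥ 2 * N, p ≤ Ω' (π i) := by
    intro i hi
    rcases Nat.even_or_odd' i with ⟨j, rfl | rfl⟩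
    · have := hN j (by omega)
      simp [h0, hΩ', hp, h𝔸.weak _ _ this.1 this.2]
    · simpa [h1, hΩ', hp] using Finset.le_sup (f := 𝔸.Ω) (Finset.mem_univ (a N))
  have hfreq : ∃ᶠ i in atTop, Ω' (π i) = p := by
    refine frequently_atTop.2 fun m => ⟨2 * (max m N), by omega, ?_⟩
    have := hN (max m N) (le_max_right _ _)
    simp [h0, hΩ', hp, h𝔸.weak _ _ this.1 this.2]
  have hnot : ∀ m < p, ¬ ∃ᶠ i in atTop, Ω' (π i) = m := by
    intro m hm hf
    obtain ⟨i, hi, he⟩ := frequently_atTop.1 hf (2 * N)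
    exact absurd (hge i hi) (by omega)
  rw [hwin]
  constructor
  · rintro ⟨m, hm, hmf, hmin⟩
    rcases lt_trichotomy m p with h | h | h
    · exact absurd hmf (hnot m h)
    · exact h ▸ hm
    · exact absurd hfreq (hmin p h)
  · exact fun he => ⟨p, he, hfreq, hnot⟩

theorem not_forall_ge_succ_lt {f : ℕ → ℕ} {N : ℕ} (h : ∀ i ≥ N, f (i + 1) < f i) : False := by
  have : ∀ i, f (N + i) + i ≤ f N := by
    intro i
    induction i with
    | zero => simp
    | succ i ih =>
      have := h (N + i) (by omega)
      rw [add_assoc] at this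
      omega
  have := this (f N + 1)
  omega

theorem exists_inr_of_edge {p q : (Fin 𝔸.n × T) ⊕ (Fin 𝔸.n → Set T)} (h : (𝔸.game M).E p q)
    {x : Fin 𝔸.n × T} (hp : p = Sum.inl x) : ∃ V, q = Sum.inr V := by
  subst hp
  rcases q with q | V
  · exact h.elim
  · exact ⟨V, rfl⟩

theorem exists_inl_of_edge {p q : (Fin 𝔸.n × T) ⊕ (Fin 𝔸.n → Set T)} (h : (𝔸.game M).E p q)
    {V : Fin 𝔸.n → Set T} (hp : p = Sum.inr V) : ∃ b t, q = Sum.inl (b, t) ∧ t ∈ V b := by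
  subst hp
  rcases q with ⟨b, t⟩ | V
  · exact ⟨b, t, rfl, h⟩
  · exact h.elim

/-- Éloise wins where acceptance holds, with a positional strategy that decreases the rank as
long as the match stays in an odd cluster. -/
theorem exists_isWinning (h𝔸 : IsContinuousWeak.{u} 𝔸) {W : Fin 𝔸.n → Set T}
    (hW : W = 𝔸.clusterSem M W) {a₀ : Fin 𝔸.n} {s₀ : T} (hs₀ : s₀ ∈ W a₀) :
    ∃ f, (𝔸.game M).IsWinning f (Sum.inl (a₀, s₀)) := by
  -- Éloise offers no states that do not occur in the one-step sentence, since by these a match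
  -- could leave the reachability order
  let U : Fin 𝔸.n × T → Fin 𝔸.n → Set T := fun q b => {t | b ∈ (𝔸.Δ q.1 (M.σ q.2)).occ ∧
    M.R q.2 t ∧ t ∈ W b ∧
      (Odd (𝔸.Ω q.1) → 𝔸.SameCluster q.1 b → 𝔸.rank M W b t < 𝔸.rank M W q.1 q.2)}
  let strat : (Fin 𝔸.n × T) ⊕ (Fin 𝔸.n → Set T) → (Fin 𝔸.n × T) ⊕ (Fin 𝔸.n → Set T) :=
    Sum.elim (fun q => Sum.inr (U q)) Sum.inr
  let f : List ((Fin 𝔸.n × T) ⊕ (Fin 𝔸.n → Set T)) → (Fin 𝔸.n × T) ⊕ (Fin 𝔸.n → Set T) :=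
    fun h => strat (h.getLast?.getD (Sum.inl (a₀, s₀)))
  let Inv : (Fin 𝔸.n × T) ⊕ (Fin 𝔸.n → Set T) → Prop :=
    Sum.elim (fun q => q.2 ∈ W q.1) (fun V => ∃ q, V = U q)
  have hf : ∀ π n, f (BoardGame.history π n) = strat (π n) := fun π n => by
    simp [f, BoardGame.getLast?_history]
  have hinv : ∀ π n, (𝔸.game M).Guided f (Sum.inl (a₀, s₀)) π n → Inv (π n) := by
    intro π n
    induction n with
    | zero => exact fun h => by rw [h.1]; exact hs₀
    | succ n ih =>
      intro h
      have hn := ih (h.mono n.le_succ)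
      obtain ⟨hE, hstr⟩ := h.2 n n.lt_succ_self
      rcases hπ : π n with q | V
      · rw [hstr ⟨q, hπ.symm⟩, hf, hπ]
        exact ⟨q, rfl⟩
      · obtain ⟨b, t, hbt, ht⟩ := exists_inl_of_edge hE hπ
        rw [hπ] at hn
        obtain ⟨q, rfl⟩ := hn
        rw [hbt]
        exact ht.2.2.1
  have hlegit : ∀ q : Fin 𝔸.n × T, q.2 ∈ W q.1 →
      (𝔸.game M).E (Sum.inl q) (Sum.inr (U q)) := by
    rintro ⟨a, s⟩ hs
    refine ⟨fun b t ht => ht.2.1, ?_⟩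
    refine fun g => (OneStep.sat_congr_occ (fun b hb => ?_) g).1 (step_of_mem h𝔸 hW hs g)
    ext d
    simp [U, hb, d.2]
  refine ⟨f, ⟨fun π n h hel _ => ?_, fun π n h hstuck hel => ?_, fun π h => ?_⟩⟩
  · obtain ⟨q, hq⟩ := hel
    have := hinv π n h
    rw [hf, ← hq]
    rw [← hq] at this
    exact hlegit q this
  · obtain ⟨q, hq⟩ := hel
    have := hinv π n h
    rw [← hq] at this
    exact hstuck _ (hq ▸ hlegit q this)
  · have hE : ∀ i, (𝔸.game M).E (π i) (π (i + 1)) := fun i => ((h (i + 1)).2 i i.lt_succ_self).1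
    have hstr : ∀ i, π i ∈ (𝔸.game M).eloise → π (i + 1) = strat (π i) := fun i hi => by
      rw [← hf]; exact ((h (i + 1)).2 i i.lt_succ_self).2 hi
    have hinl : ∀ i, ∃ q, π (2 * i) = Sum.inl q := by
      intro i
      induction i with
      | zero => exact ⟨_, (h 0).1⟩
      | succ i ih =>
        obtain ⟨q, hq⟩ := ih
        obtain ⟨V, hV⟩ := exists_inr_of_edge (hE (2 * i)) hq
        obtain ⟨b, t, hbt, -⟩ := exists_inl_of_edge (hE (2 * i + 1)) hV
        exact ⟨_, hbt⟩
    choose q hq using hinl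
    have hV : ∀ i, π (2 * i + 1) = Sum.inr (U (q i)) := fun i => by
      rw [hstr _ ⟨_, (hq i).symm⟩, hq]; rfl
    have hmem : ∀ i, (q (i + 1)).2 ∈ U (q i) (q (i + 1)).1 := by
      intro i
      obtain ⟨b, t, hbt, ht⟩ := exists_inl_of_edge (hE (2 * i + 1)) (hV i)
      have : Sum.inl (q (i + 1)) = Sum.inl (b, t) := (hq (i + 1)).symm.trans hbt
      rw [Sum.inl.inj this]
      exact ht
    obtain ⟨N, hN⟩ := exists_sameCluster (fun i => (q i).1)
      fun i => reach_of_mem_occ (hmem i).1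
    rw [mem_win_iff h𝔸 (a := fun i => (q i).1) (s := fun i => (q i).2) hq hV hN]
    by_contra hne
    rw [Nat.not_even_iff_odd] at hne
    refine not_forall_ge_succ_lt (N := N) (f := fun i => 𝔸.rank M W (q i).1 (q i).2)
      fun i hi => ?_
    have hc := hN i hi
    exact (hmem i).2.2.2 (h𝔸.weak _ _ hc.1 hc.2 ▸ hne) (hc.symm.trans (hN (i + 1) (by omega)))

/-- Where acceptance fails, Abelard defeats every strategy, decreasing the rank as long as the
match stays in an even cluster. -/
theorem not_isWinning (h𝔸 : IsContinuousWeak.{u} 𝔸) {W : Fin 𝔸.n → Set T}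
    (hW : W = 𝔸.clusterSem M W) {a₀ : Fin 𝔸.n} {s₀ : T} (hs₀ : s₀ ∉ W a₀)
    (f : List ((Fin 𝔸.n × T) ⊕ (Fin 𝔸.n → Set T)) → (Fin 𝔸.n × T) ⊕ (Fin 𝔸.n → Set T)) :
    ¬ (𝔸.game M).IsWinning f (Sum.inl (a₀, s₀)) := by
  classical
  intro hf
  -- the moves that Abelard is after, at a valuation chosen by Éloise at `q`
  let Good : Fin 𝔸.n × T → (Fin 𝔸.n → Set T) → Fin 𝔸.n × T → Prop := fun q V q' =>
    q'.1 ∈ (𝔸.Δ q.1 (M.σ q.2)).occ ∧ q'.2 ∈ V q'.1 ∧ q'.2 ∉ W q'.1 ∧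
      (Even (𝔸.Ω q.1) → 𝔸.SameCluster q.1 q'.1 →
        𝔸.rank M W q'.1 q'.2 < 𝔸.rank M W q.1 q.2)
  have hgood : ∀ q V, q.2 ∉ W q.1 → (𝔸.game M).E (Sum.inl q) (Sum.inr V) →
      ∃ q', Good q V q' := by
    rintro ⟨a, s⟩ V hs hE
    by_contra hno
    refine not_step_of_notMem h𝔸 hW hs (step_mono h𝔸 (fun b hb t ht => ?_) hE.2)
    by_contra hcon
    simp only [mem_ofPred_eq, not_or, not_and, not_not] at hcon
    exact hno ⟨(b, t), hb, ht.1, hcon.1, hcon.2⟩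
  -- `F` follows `f` at the positions of Éloise and makes a good move at those of Abelard
  let F : List ((Fin 𝔸.n × T) ⊕ (Fin 𝔸.n → Set T)) → (Fin 𝔸.n × T) ⊕ (Fin 𝔸.n → Set T) :=
    fun h => if (∃ q, h.getLast? = some (Sum.inl q)) then f h else
      Classical.epsilon fun p => ∃ q V q', h.dropLast.getLast? = some (Sum.inl q) ∧
        h.getLast? = some (Sum.inr V) ∧ Good q V q' ∧ p = Sum.inl q'
  have : Nonempty ((Fin 𝔸.n × T) ⊕ (Fin 𝔸.n → Set T)) := ⟨Sum.inl (a₀, s₀)⟩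
  obtain ⟨π, hπ0, hπ⟩ := BoardGame.exists_sequence F (Sum.inl (a₀, s₀))
  have hinl : ∀ i q, π i = Sum.inl q → π (i + 1) = f (BoardGame.history π i) := by
    intro i q hq
    rw [hπ]
    exact if_pos ⟨q, by rw [BoardGame.getLast?_history, hq]⟩
  have hround : ∀ i q, π (2 * i) = Sum.inl q → q.2 ∉ W q.1 →
      (𝔸.game M).Guided f (Sum.inl (a₀, s₀)) π (2 * i) →
      ∃ V q', π (2 * i + 1) = Sum.inr V ∧ π (2 * (i + 1)) = Sum.inl q' ∧ Good q V q' ∧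
        (𝔸.game M).Guided f (Sum.inl (a₀, s₀)) π (2 * (i + 1)) := by
    intro i q hq hqW hG
    have hmove : ∃ w, (𝔸.game M).E (π (2 * i)) w := by
      by_contra hno
      exact hf.not_stuck π _ hG (fun w hw => hno ⟨w, hw⟩) ⟨q, hq.symm⟩
    have hE := hf.legitimate π _ hG ⟨q, hq.symm⟩ hmove
    rw [← hinl _ q hq] at hE
    obtain ⟨V, hV⟩ := exists_inr_of_edge hE hq
    have hex := hgood q V hqW (by rwa [hq, hV] at hE)
    have hsel : ∃ q', Good q V q' ∧ π (2 * i + 1 + 1) = Sum.inl q' := by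
      have hnot : ¬ ∃ q, (BoardGame.history π (2 * i + 1)).getLast? = some (Sum.inl q) := by
        rw [BoardGame.getLast?_history, hV]
        simp
      have hval : π (2 * i + 1 + 1) = Classical.epsilon fun p => ∃ q V q',
          some (π (2 * i)) = some (Sum.inl q) ∧ some (π (2 * i + 1)) = some (Sum.inr V) ∧
            Good q V q' ∧ p = Sum.inl q' := by
        rw [hπ, ← BoardGame.getLast?_history π (2 * i),
          ← BoardGame.getLast?_history π (2 * i + 1), ← BoardGame.dropLast_history_succ π (2 * i)]
        exact if_neg hnot
      obtain ⟨q', hq'⟩ := hex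
      obtain ⟨q₁, V₁, q₂, e1, e2, hg, hp⟩ := Classical.epsilon_spec
        (p := fun p => ∃ q V q', some (π (2 * i)) = some (Sum.inl q) ∧
          some (π (2 * i + 1)) = some (Sum.inr V) ∧ Good q V q' ∧ p = Sum.inl q')
        ⟨Sum.inl q', q, V, q', by rw [hq], by rw [hV], hq', rfl⟩
      rw [hq, Option.some.injEq, Sum.inl.injEq] at e1
      rw [hV, Option.some.injEq, Sum.inr.injEq] at e2
      subst e1 e2
      exact ⟨q₂, hg, hval.trans hp⟩
    obtain ⟨q', hg, hq'⟩ := hsel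
    refine ⟨V, q', hV, hq', hg, hG.1, fun j hj => ?_⟩
    rcases (by omega : j < 2 * i ∨ j = 2 * i ∨ j = 2 * i + 1) with h | rfl | rfl
    · exact hG.2 j h
    · exact ⟨hE, fun _ => hinl _ q hq⟩
    · refine ⟨?_, fun ⟨r, hr⟩ => ?_⟩
      · rw [hV, hq']
        exact hg.2.1
      · rw [hV] at hr
        exact (Sum.inl_ne_inr hr).elim
  have hinv : ∀ i, ∃ q, π (2 * i) = Sum.inl q ∧ q.2 ∉ W q.1 ∧
      (𝔸.game M).Guided f (Sum.inl (a₀, s₀)) π (2 * i) := by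
    intro i
    induction i with
    | zero => exact ⟨_, hπ0, hs₀, hπ0, fun j hj => absurd hj (by omega)⟩
    | succ i ih =>
      obtain ⟨q, hq, hqW, hG⟩ := ih
      obtain ⟨V, q', -, hq', hg, hG'⟩ := hround i q hq hqW hG
      exact ⟨q', hq', hg.2.2.1, hG'⟩
  choose q hq hqW hG using hinv
  choose V q' hV hq' hg _ using fun i => hround i (q i) (hq i) (hqW i) (hG i)
  have hqq : ∀ i, q' i = q (i + 1) := fun i => Sum.inl.inj ((hq' i).symm.trans (hq (i + 1)))
  obtain ⟨N, hN⟩ := exists_sameCluster (fun i => (q i).1)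
    fun i => hqq i ▸ reach_of_mem_occ (hg i).1
  have hwin := hf.infinite π fun n => (hG n).mono (by omega)
  rw [mem_win_iff h𝔸 (a := fun i => (q i).1) (s := fun i => (q i).2) hq hV hN] at hwin
  refine not_forall_ge_succ_lt (N := N) (f := fun i => 𝔸.rank M W (q i).1 (q i).2)
    fun i hi => ?_
  have hc := hN i hi
  have hlt := (hg i).2.2.2 (h𝔸.weak _ _ hc.1 hc.2 ▸ hwin)
  rw [hqq i] at hlt
  exact hlt (hc.symm.trans (hN (i + 1) (by omega)))

theorem accepts_iff (h𝔸 : IsContinuousWeak.{u} 𝔸) :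
    𝔸.Accepts M ↔ M.root ∈ 𝔸.level M 𝔸.n 𝔸.start :=
  ⟨fun ⟨f, hf⟩ => by_contra fun h => not_isWinning h𝔸 level_eq_clusterSem h f hf,
    fun h => exists_isWinning h𝔸 level_eq_clusterSem h⟩

end ParityAutomaton

/-! ### Recursion over codes of formulas -/

/-- Recursion over numbers that code trees: the value at `n = pair i m`, `m = pair l r`, is
computed by `g` from `n` and from the values at `m`, `l` and `r`, each of which is replaced by
`default` unless it is smaller than `n`. -/
def treeFold {σ : Type} [Inhabited σ] (g : ℕ → σ → σ → σ → σ) (n : ℕ) : σ :=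
  g n (if _h : n.unpair.2 < n then treeFold g n.unpair.2 else default)
    (if _h : n.unpair.2.unpair.1 < n then treeFold g n.unpair.2.unpair.1 else default)
    (if _h : n.unpair.2.unpair.2 < n then treeFold g n.unpair.2.unpair.2 else default)
  termination_by n

theorem lt_pair_right {i m : ℕ} (hi : 0 < i) : m < Nat.pair i m :=
  (Nat.add_le_pair i m).trans_lt' (by omega)

theorem treeFold_pair {σ : Type} [Inhabited σ] (g : ℕ → σ → σ → σ → σ) {i : ℕ} (hi : 0 < i)
    (m : ℕ) : treeFold g (Nat.pair i m) = g (Nat.pair i m) (treeFold g m)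
      (treeFold g m.unpair.1) (treeFold g m.unpair.2) := by
  rw [treeFold]
  simp only [Nat.unpair_pair]
  rw [dif_pos (lt_pair_right hi), dif_pos ((Nat.unpair_left_le m).trans_lt (lt_pair_right hi)),
    dif_pos ((Nat.unpair_right_le m).trans_lt (lt_pair_right hi))]

theorem Primrec.treeFold {α σ : Type} [Primcodable α] [Primcodable σ] [Inhabited σ]
    {g : α → ℕ → σ → σ → σ → σ}
    (hg : Primrec fun p : α × ℕ × σ × σ × σ => g p.1 p.2.1 p.2.2.1 p.2.2.2.1 p.2.2.2.2) :
    Primrec₂ fun a n => treeFold (g a) n := by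
  let G : α → List σ → Option σ := fun a l => some (g a l.length
    (l.getD l.length.unpair.2 default) (l.getD l.length.unpair.2.unpair.1 default)
    (l.getD l.length.unpair.2.unpair.2 default))
  have hG : Primrec₂ G := by
    have hl : Primrec fun p : α × List σ => p.2.length := Primrec.list_length.comp Primrec.snd
    have hm := Primrec.snd.comp (Primrec.unpair.comp hl)
    have hd : ∀ {f : α × List σ → ℕ}, Primrec f →
        Primrec fun p : α × List σ => p.2.getD (f p) default :=
      fun hf => (Primrec.list_getD default).comp Primrec.snd hf
    exact Primrec.option_some.comp (hg.comp (Primrec.fst.pair (hl.pair ((hd hm).pair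
      ((hd (Primrec.fst.comp (Primrec.unpair.comp hm))).pair
        (hd (Primrec.snd.comp (Primrec.unpair.comp hm))))))))
  refine Primrec.nat_strong_rec _ hG fun a n => ?_
  have hget : ∀ m, ((List.range n).map (_root_.treeFold (g a))).getD m default =
      if _h : m < n then _root_.treeFold (g a) m else default := by
    intro m
    by_cases h : m < n <;> simp [h]
  simp only [G, List.length_map, List.length_range, hget]
  conv_rhs => rw [_root_.treeFold]

/-! ### Primitive recursive operations on formulas -/

namespace WMSO

open Classical in
noncomputable instance : Encodable WMSO where
  encode := code
  decode n := if h : ∃ φ, code φ = n then some h.choose else none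
  encodek φ := by
    have h : ∃ ψ, code ψ = code φ := ⟨φ, rfl⟩
    simp only [h, dif_pos, Option.some.injEq]
    exact code_injective h.choose_spec

/-- The recursion step that decides whether a number is the code of a formula. -/
def isCodeStep (n : ℕ) (r₀ r₁ r₂ : Bool) : Bool :=
  if n.unpair.1 < 3 then true else if n.unpair.1 = 3 then r₀ else
    if n.unpair.1 = 4 then r₁ && r₂ else if n.unpair.1 = 5 then r₂ else false

theorem treeFold_isCodeStep (n : ℕ) :
    treeFold isCodeStep n = true ↔ ∃ φ, code φ = n := by
  induction n using Nat.strong_induction_on with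
  | _ n ih =>
    obtain ⟨i, m, rfl⟩ : ∃ i m, n = Nat.pair i m := ⟨_, _, (Nat.pair_unpair n).symm⟩
    rcases Nat.lt_or_ge i 3 with hi | hi
    · have : treeFold isCodeStep (Nat.pair i m) = true := by
        rw [treeFold]; simp [isCodeStep, hi]
      refine ⟨fun _ => ?_, fun _ => this⟩
      interval_cases i
      · exact ⟨here m, rfl⟩
      · exact ⟨sub m.unpair.1 m.unpair.2, by simp [code]⟩
      · exact ⟨rel m.unpair.1 m.unpair.2, by simp [code]⟩
    · have hm : m < Nat.pair i m := lt_pair_right (by omega)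
      have ih₀ := ih m hm
      have ih₁ := ih m.unpair.1 ((Nat.unpair_left_le m).trans_lt hm)
      have ih₂ := ih m.unpair.2 ((Nat.unpair_right_le m).trans_lt hm)
      rw [treeFold_pair _ (by omega)]
      simp only [isCodeStep, Nat.unpair_pair, not_lt.2 hi, if_false]
      constructor
      · intro h
        split_ifs at h with h3 h4 h5
        · obtain ⟨φ, hφ⟩ := ih₀.1 h
          exact ⟨neg φ, by rw [code, hφ, h3]⟩
        · rw [Bool.and_eq_true] at h
          obtain ⟨φ, hφ⟩ := ih₁.1 h.1
          obtain ⟨ψ, hψ⟩ := ih₂.1 h.2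
          exact ⟨or φ ψ, by rw [code, hφ, hψ, h4, Nat.pair_unpair]⟩
        · obtain ⟨φ, hφ⟩ := ih₂.1 h
          exact ⟨ex m.unpair.1 φ, by rw [code, hφ, h5, Nat.pair_unpair]⟩
      · rintro ⟨φ, hφ⟩
        cases φ with
        | here p => simp only [code, Nat.pair_eq_pair] at hφ; omega
        | sub p q => simp only [code, Nat.pair_eq_pair] at hφ; omega
        | rel p q => simp only [code, Nat.pair_eq_pair] at hφ; omega
        | neg φ =>
          simp only [code, Nat.pair_eq_pair] at hφ
          simp [← hφ.1, ih₀.2 ⟨φ, hφ.2⟩]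
        | or φ ψ =>
          simp only [code, Nat.pair_eq_pair] at hφ
          simp [← hφ.1, ih₁.2 ⟨φ, by simp [← hφ.2]⟩, ih₂.2 ⟨ψ, by simp [← hφ.2]⟩]
        | ex p φ =>
          simp only [code, Nat.pair_eq_pair] at hφ
          simp [← hφ.1, ih₂.2 ⟨φ, by simp [← hφ.2]⟩]

theorem primrec_treeFold_isCodeStep : Primrec (treeFold isCodeStep) := by
  have htag : Primrec fun p : Unit × ℕ × Bool × Bool × Bool => p.2.1.unpair.1 :=
    Primrec.fst.comp (Primrec.unpair.comp (Primrec.fst.comp Primrec.snd))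
  have heq : ∀ c, PrimrecPred fun p : Unit × ℕ × Bool × Bool × Bool => p.2.1.unpair.1 = c :=
    fun c => Primrec.eq.comp htag (Primrec.const c)
  have h0 : Primrec fun p : Unit × ℕ × Bool × Bool × Bool => p.2.2.1 :=
    Primrec.fst.comp (Primrec.snd.comp Primrec.snd)
  have h1 : Primrec fun p : Unit × ℕ × Bool × Bool × Bool => p.2.2.2.1 :=
    Primrec.fst.comp (Primrec.snd.comp (Primrec.snd.comp Primrec.snd))
  have h2 : Primrec fun p : Unit × ℕ × Bool × Bool × Bool => p.2.2.2.2 :=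
    Primrec.snd.comp (Primrec.snd.comp (Primrec.snd.comp Primrec.snd))
  have hg : Primrec fun p : Unit × ℕ × Bool × Bool × Bool =>
      isCodeStep p.2.1 p.2.2.1 p.2.2.2.1 p.2.2.2.2 :=
    Primrec.ite (Primrec.nat_lt.comp htag (Primrec.const 3)) (Primrec.const true)
      (Primrec.ite (heq 3) h0 (Primrec.ite (heq 4) (Primrec.and.comp h1 h2)
        (Primrec.ite (heq 5) h2 (Primrec.const false))))
  exact (Primrec.treeFold (g := fun _ : Unit => isCodeStep) hg).comp
    (Primrec.const ()) Primrec.id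

/-- The coding of formulas by their Gödel numbers is primitive recursive. -/
noncomputable instance : Primcodable WMSO where
  prim := by
    have h : Primrec fun n => bif treeFold isCodeStep n then n.succ else 0 :=
      Primrec.cond primrec_treeFold_isCodeStep Primrec.succ (Primrec.const 0)
    refine (Primrec.nat_iff.1 h).of_eq fun n => ?_
    by_cases hn : ∃ φ, code φ = n
    · have hd : (Encodable.decode n : Option WMSO) = some hn.choose := dif_pos hn
      rw [hd, (treeFold_isCodeStep n).2 hn]
      exact congrArg Nat.succ hn.choose_spec.symm
    · have hd : (Encodable.decode n : Option WMSO) = none := dif_neg hn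
      rw [hd, Bool.eq_false_iff.2 (mt (treeFold_isCodeStep n).1 hn)]
      rfl

instance : Inhabited WMSO := ⟨sub 0 0⟩

theorem primrec_here : Primrec here :=
  Primrec.encode_iff.1 (Primrec₂.natPair.comp (Primrec.const 0) Primrec.id)

theorem primrec_sub : Primrec₂ sub :=
  Primrec₂.encode_iff.1 (Primrec₂.natPair.comp₂ (Primrec₂.const 1) Primrec₂.natPair)

theorem primrec_rel : Primrec₂ rel :=
  Primrec₂.encode_iff.1 (Primrec₂.natPair.comp₂ (Primrec₂.const 2) Primrec₂.natPair)

theorem primrec_neg : Primrec neg :=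
  Primrec.encode_iff.1 (Primrec₂.natPair.comp (Primrec.const 3) Primrec.encode)

theorem primrec_or : Primrec₂ or :=
  Primrec₂.encode_iff.1 (Primrec₂.natPair.comp₂ (Primrec₂.const 4) (Primrec₂.natPair.comp₂
    (Primrec.encode.comp₂ Primrec₂.left) (Primrec.encode.comp₂ Primrec₂.right)))

theorem primrec_ex : Primrec₂ ex :=
  Primrec₂.encode_iff.1 (Primrec₂.natPair.comp₂ (Primrec₂.const 5) (Primrec₂.natPair.comp₂
    Primrec₂.left (Primrec.encode.comp₂ Primrec₂.right)))

end WMSO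

/-! ### Definable notions of weak monadic second-order logic -/

namespace WMSO

/-- The free letters of `φ` are among `0, …, k - 1` and the elements of `S`, and the bound
letters are not below `k`. -/
def Over (k : ℕ) (S : Set ℕ) (φ : WMSO) : Prop :=
  (∀ p ∈ φ.free, p < k ∨ p ∈ S) ∧ ∀ p ∈ φ.bound, k ≤ p

section Over

variable {k : ℕ} {S S' : Set ℕ} {φ ψ : WMSO} {p q : ℕ}

theorem Over.mono (h : Over k S φ) (hS : S ⊆ S') : Over k S' φ :=
  ⟨fun p hp => (h.1 p hp).imp_right fun h => hS h, h.2⟩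

theorem over_here (hp : p < k ∨ p ∈ S) : Over k S (here p) := by
  simp [Over, free, bound, hp]

theorem over_sub (hp : p < k ∨ p ∈ S) (hq : q < k ∨ q ∈ S) : Over k S (sub p q) := by
  simp [Over, free, bound, hp, hq]

theorem over_rel (hp : p < k ∨ p ∈ S) (hq : q < k ∨ q ∈ S) : Over k S (rel p q) := by
  simp [Over, free, bound, hp, hq]

theorem over_neg (h : Over k S φ) : Over k S (neg φ) := h

theorem over_or (h : Over k S φ) (h' : Over k S ψ) : Over k S (or φ ψ) := by
  refine ⟨fun p hp => ?_, fun p hp => ?_⟩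
  · exact (Finset.mem_union.1 hp).elim (h.1 p) (h'.1 p)
  · exact (Finset.mem_union.1 hp).elim (h.2 p) (h'.2 p)

theorem over_ex (hp : k ≤ p) (h : Over k (insert p S) φ) : Over k S (ex p φ) := by
  refine ⟨fun q hq => ?_, fun q hq => ?_⟩
  · obtain ⟨hqp, hq⟩ := Finset.mem_erase.1 hq
    exact (h.1 q hq).imp_right fun h => h.resolve_left hqp
  · exact (Finset.mem_insert.1 hq).elim (fun e => e ▸ hp) (h.2 q)

theorem Over.isOver (h : Over k ∅ φ) : φ.IsOver k := by
  have hlt : ∀ p ∈ φ.free, p < k := fun p hp => (h.1 p hp).resolve_right (notMem_empty p)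
  refine ⟨hlt, Finset.disjoint_left.2 fun p hp hp' => ?_⟩
  exact absurd (hlt p hp) (not_lt.2 (h.2 p hp'))

end Over

/-- Conjunction. -/
def and (φ ψ : WMSO) : WMSO := neg (or (neg φ) (neg ψ))

/-- A valid formula; its letter `p` is irrelevant. -/
def top (p : ℕ) : WMSO := sub p p

/-- Conjunction of a list of formulas; the letter `p` is irrelevant. -/
def bigAnd (p : ℕ) (l : List WMSO) : WMSO := l.foldr and (top p)

/-- Disjunction of a list of formulas; the letter `p` is irrelevant. -/
def bigOr (p : ℕ) (l : List WMSO) : WMSO := l.foldr or (neg (top p))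

/-- Quantification over all letters of a list. -/
def exs (l : List ℕ) (φ : WMSO) : WMSO := l.foldr ex φ

/-! The letters from `k` on serve as bound variables: `node k` for the current node, `few k` for
a finite exceptional set, `aux k` and `aux' k` for auxiliary sets, `box k` for the finite set to
which a fixpoint is relativized, `var k x` for the individual variable `x` of the one-step
language, and `state k b` for the approximation of the fixpoint at the state `b`. -/

/-- The letter for the current node. -/
def node (k : ℕ) : ℕ := k
/-- The letter for a finite exceptional set. -/
def few (k : ℕ) : ℕ := k + 1
/-- An auxiliary letter. -/
def aux (k : ℕ) : ℕ := k + 2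
/-- An auxiliary letter. -/
def aux' (k : ℕ) : ℕ := k + 3
/-- The letter for the finite set to which a fixpoint is relativized. -/
def box (k : ℕ) : ℕ := k + 4
/-- The letter for the individual variable `x`. -/
def var (k x : ℕ) : ℕ := k + 5 + 2 * x
/-- The letter for the approximation of the fixpoint at the state `b`. -/
def state (k b : ℕ) : ℕ := k + 6 + 2 * b

theorem node_ne_few (k : ℕ) : node k ≠ few k := by unfold node few; omega
theorem node_ne_var (k x : ℕ) : node k ≠ var k x := by unfold node var; omega
theorem few_ne_var (k x : ℕ) : few k ≠ var k x := by unfold few var; omega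
theorem var_ne_few (k x : ℕ) : var k x ≠ few k := (few_ne_var k x).symm
theorem var_ne_aux (k x : ℕ) : var k x ≠ aux k := by unfold aux var; omega
theorem var_ne_aux' (k x : ℕ) : var k x ≠ aux' k := by unfold aux' var; omega
theorem aux_ne_aux' (k : ℕ) : aux k ≠ aux' k := by unfold aux aux'; omega
theorem node_ne_aux (k : ℕ) : node k ≠ aux k := by unfold node aux; omega
theorem node_ne_aux' (k : ℕ) : node k ≠ aux' k := by unfold node aux'; omega
theorem node_ne_box (k : ℕ) : node k ≠ box k := by unfold node box; omega
theorem box_ne_node (k : ℕ) : box k ≠ node k := (node_ne_box k).symm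
theorem node_ne_state (k b : ℕ) : node k ≠ state k b := by unfold node state; omega
theorem state_ne_node (k b : ℕ) : state k b ≠ node k := (node_ne_state k b).symm
theorem box_ne_state (k b : ℕ) : box k ≠ state k b := by unfold box state; omega
theorem state_ne_few (k b : ℕ) : state k b ≠ few k := by unfold state few; omega
theorem state_ne_var (k b x : ℕ) : state k b ≠ var k x := by unfold state var; omega
theorem var_inj {k x y : ℕ} : var k x = var k y ↔ x = y := by unfold var; omega
theorem state_inj {k x y : ℕ} : state k x = state k y ↔ x = y := by unfold state; omega
theorem le_few (k : ℕ) : k ≤ few k := by unfold few; omega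
theorem le_aux (k : ℕ) : k ≤ aux k := by unfold aux; omega
theorem le_aux' (k : ℕ) : k ≤ aux' k := by unfold aux'; omega
theorem le_box (k : ℕ) : k ≤ box k := by unfold box; omega
theorem le_var (k x : ℕ) : k ≤ var k x := by unfold var; omega
theorem le_state (k b : ℕ) : k ≤ state k b := by unfold state; omega

/-- The letter `p` is true somewhere. -/
def nonempty (k p : ℕ) : WMSO := ex (aux' k) (neg (sub p (aux' k)))

/-- The letter `p` is true at exactly one node. -/
def single (k p : ℕ) : WMSO :=
  and (nonempty k p)
    (neg (ex (aux k) (and (sub (aux k) p) (and (nonempty k (aux k)) (neg (sub p (aux k)))))))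

/-- Some successor of the current node, named by the variable `x`, satisfies `φ`. -/
def someSucc (k x : ℕ) (φ : WMSO) : WMSO :=
  ex (var k x) (and (single k (var k x)) (and (rel (node k) (var k x)) φ))

/-- Only finitely many successors of the current node, named by `x`, satisfy `φ`. -/
def fewSucc (k x : ℕ) (φ : WMSO) : WMSO :=
  ex (few k) (neg (someSucc k x (and φ (neg (sub (var k x) (few k))))))

section Semantics

variable {T : Type u} {R : T → T → Prop} {root : T} {ν : ℕ → Set T} {k p : ℕ}

theorem sat_sub {q : ℕ} : Sat R root ν (sub p q) ↔ ν p ⊆ ν q := Iff.rfl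

theorem sat_rel {q : ℕ} : Sat R root ν (rel p q) ↔ ∀ s ∈ ν p, ∃ t ∈ ν q, R s t := Iff.rfl

theorem sat_neg {φ : WMSO} : Sat R root ν (neg φ) ↔ ¬ Sat R root ν φ := Iff.rfl

theorem sat_or {φ ψ : WMSO} : Sat R root ν (or φ ψ) ↔ Sat R root ν φ ∨ Sat R root ν ψ := Iff.rfl

theorem sat_ex {φ : WMSO} : Sat R root ν (ex p φ) ↔
    ∃ X : Set T, X.Finite ∧ Sat R root (Function.update ν p X) φ := Iff.rfl

@[simp] theorem sat_and {φ ψ : WMSO} :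
    Sat R root ν (and φ ψ) ↔ Sat R root ν φ ∧ Sat R root ν ψ := by
  simp only [and, sat_neg, sat_or, not_or, not_not]

@[simp] theorem sat_top : Sat R root ν (top p) := Subset.rfl

theorem sat_bigAnd {l : List WMSO} :
    Sat R root ν (bigAnd p l) ↔ ∀ φ ∈ l, Sat R root ν φ := by
  induction l with
  | nil => simp [bigAnd]
  | cons φ l ih =>
    have : bigAnd p (φ :: l) = and φ (bigAnd p l) := rfl
    simp [this, ih]

theorem sat_bigOr {l : List WMSO} :
    Sat R root ν (bigOr p l) ↔ ∃ φ ∈ l, Sat R root ν φ := by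
  induction l with
  | nil => simp [bigOr, sat_neg]
  | cons φ l ih =>
    have : bigOr p (φ :: l) = or φ (bigOr p l) := rfl
    simp [this, sat_or, ih]

theorem sat_exs {l : List ℕ} {φ : WMSO} : Sat R root ν (exs l φ) ↔
    ∃ ν' : ℕ → Set T, (∀ q ∉ l, ν' q = ν q) ∧ (∀ q ∈ l, (ν' q).Finite) ∧ Sat R root ν' φ := by
  induction l generalizing ν with
  | nil =>
    refine ⟨fun h => ⟨ν, fun _ _ => rfl, fun _ hq => absurd hq (List.not_mem_nil), h⟩, fun ⟨ν', h, _, h'⟩ => ?_⟩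
    have : ν' = ν := funext fun q => h q (by simp)
    exact this ▸ h'
  | cons b l ih =>
    change (∃ X : Set T, X.Finite ∧ Sat R root (Function.update ν b X) (exs l φ)) ↔ _
    simp only [ih]
    constructor
    · rintro ⟨X, hX, ν', h1, h2, h3⟩
      refine ⟨ν', fun q hq => ?_, fun q hq => ?_, h3⟩
      · rw [List.mem_cons, not_or] at hq
        rw [h1 q hq.2, Function.update_of_ne hq.1]
      · by_cases hql : q ∈ l
        · exact h2 q hql
        · obtain rfl := (List.mem_cons.1 hq).resolve_right hql
          rw [h1 q hql, Function.update_self]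
          exact hX
    · rintro ⟨ν', h1, h2, h3⟩
      refine ⟨ν' b, h2 b (by simp), ν', fun q hq => ?_, fun q hq => h2 q (by simp [hq]), h3⟩
      by_cases hqb : q = b
      · subst hqb; simp
      · rw [Function.update_of_ne hqb, h1 q (by simp [hq, hqb])]

theorem sat_nonempty (hp : p ≠ aux' k) : Sat R root ν (nonempty k p) ↔ (ν p).Nonempty := by
  simp only [nonempty, sat_ex, sat_neg, sat_sub, Function.update_self, Function.update_of_ne hp]
  refine ⟨fun ⟨X, _, h⟩ => ?_, fun h => ⟨∅, finite_empty, fun h' => ?_⟩⟩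
  · obtain ⟨t, ht, -⟩ := not_subset.1 h
    exact ⟨t, ht⟩
  · exact h.ne_empty (subset_empty_iff.1 h')

theorem sat_single (hp : p ≠ aux k) (hp' : p ≠ aux' k) :
    Sat R root ν (single k p) ↔ ∃ t, ν p = {t} := by
  simp only [single, sat_and, sat_nonempty hp', sat_neg, sat_ex, sat_sub,
    sat_nonempty (aux_ne_aux' k), Function.update_self, Function.update_of_ne hp]
  constructor
  · rintro ⟨⟨t, ht⟩, h⟩
    refine ⟨t, Subset.antisymm ?_ (singleton_subset_iff.2 ht)⟩
    by_contra h'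
    exact h ⟨{t}, finite_singleton t, singleton_subset_iff.2 ht, singleton_nonempty t, h'⟩
  · rintro ⟨t, ht⟩
    rw [ht]
    refine ⟨singleton_nonempty t, ?_⟩
    rintro ⟨X, -, hX, hne, h⟩
    exact h (hne.subset_singleton_iff.1 hX).ge

theorem sat_someSucc {s : T} (hs : ν (node k) = {s}) {x : ℕ} {φ : WMSO} :
    Sat R root ν (someSucc k x φ) ↔
      ∃ d : {t // R s t}, Sat R root (Function.update ν (var k x) {(d : T)}) φ := by
  simp only [someSucc, sat_ex, sat_and, sat_rel, sat_single (var_ne_aux k x) (var_ne_aux' k x),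
    Function.update_self, Function.update_of_ne (node_ne_var k x), hs, mem_singleton_iff, forall_eq]
  constructor
  · rintro ⟨X, -, ⟨d, rfl⟩, ⟨t, rfl, hst⟩, h⟩
    exact ⟨⟨t, hst⟩, h⟩
  · rintro ⟨d, h⟩
    exact ⟨{(d : T)}, finite_singleton _, ⟨d, rfl⟩, ⟨d, rfl, d.2⟩, h⟩

theorem sat_fewSucc {s : T} (hs : ν (node k) = {s}) {x : ℕ} {φ : WMSO} {P : {t // R s t} → Prop}
    (hP : ∀ X (d : {t // R s t}),
      Sat R root (Function.update (Function.update ν (few k) X) (var k x) {(d : T)}) φ ↔ P d) :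
    Sat R root ν (fewSucc k x φ) ↔ {d | P d}.Finite := by
  have hs' : ∀ X, Function.update ν (few k) X (node k) = {s} := fun X => by
    rw [Function.update_of_ne (node_ne_few k), hs]
  simp only [fewSucc, sat_ex, sat_neg, sat_sub, sat_someSucc (hs' _), sat_and, hP, Function.update_self,
    Function.update_of_ne (few_ne_var k x), singleton_subset_iff, not_exists,
    not_and, not_not]
  refine ⟨fun ⟨X, hX, h⟩ => (hX.preimage Subtype.val_injective.injOn).subset h, fun h => ?_⟩
  exact ⟨_, h.image Subtype.val, fun d hd => mem_image_of_mem _ hd⟩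

end Semantics

section OverLemmas

variable {k : ℕ} {S : Set ℕ} {φ ψ : WMSO} {p : ℕ}

theorem over_and (h : Over k S φ) (h' : Over k S ψ) : Over k S (and φ ψ) := over_or h h'

theorem over_top (hp : p < k ∨ p ∈ S) : Over k S (top p) := over_sub hp hp

theorem over_bigAnd {l : List WMSO} (hp : p < k ∨ p ∈ S) (h : ∀ φ ∈ l, Over k S φ) :
    Over k S (bigAnd p l) := by
  induction l with
  | nil => exact over_top hp
  | cons φ l ih =>
    exact over_and (h φ (by simp)) (ih fun ψ hψ => h ψ (by simp [hψ]))

theorem over_bigOr {l : List WMSO} (hp : p < k ∨ p ∈ S) (h : ∀ φ ∈ l, Over k S φ) :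
    Over k S (bigOr p l) := by
  induction l with
  | nil => exact over_top hp
  | cons φ l ih =>
    exact over_or (h φ (by simp)) (ih fun ψ hψ => h ψ (by simp [hψ]))

theorem over_exs {l : List ℕ} (hl : ∀ q ∈ l, k ≤ q) (h : Over k (S ∪ {q | q ∈ l}) φ) :
    Over k S (exs l φ) := by
  induction l generalizing S with
  | nil => exact h.mono (by simp)
  | cons b l ih =>
    refine over_ex (hl b (by simp)) (ih (fun q hq => hl q (by simp [hq])) (h.mono ?_))
    rintro q (hq | hq)
    · exact Or.inl (Or.inr hq)
    · rcases List.mem_cons.1 hq with rfl | hq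
      · exact Or.inl (Or.inl rfl)
      · exact Or.inr hq

theorem over_nonempty (hp : p < k ∨ p ∈ S) : Over k S (nonempty k p) :=
  over_ex (le_aux' k) (over_neg (over_sub (hp.imp_right Or.inr) (Or.inr (Or.inl rfl))))

theorem over_single (hp : p < k ∨ p ∈ S) : Over k S (single k p) := by
  have ha : aux k < k ∨ aux k ∈ insert (aux k) S := Or.inr (Or.inl rfl)
  have hp' : p < k ∨ p ∈ insert (aux k) S := hp.imp_right Or.inr
  exact over_and (over_nonempty hp) (over_neg (over_ex (le_aux k) (over_and (over_sub ha hp')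
    (over_and (over_nonempty ha) (over_neg (over_sub hp' ha))))))

theorem over_someSucc (hn : node k ∈ S) {x : ℕ} (h : Over k (insert (var k x) S) φ) :
    Over k S (someSucc k x φ) :=
  have hx : var k x < k ∨ var k x ∈ insert (var k x) S := Or.inr (Or.inl rfl)
  over_ex (le_var k x) (over_and (over_single hx)
    (over_and (over_rel (Or.inr (Or.inr hn)) hx) h))

theorem over_fewSucc (hn : node k ∈ S) {x : ℕ} (h : Over k (insert (var k x) S) φ) :
    Over k S (fewSucc k x φ) :=
  over_ex (le_few k) (over_neg (over_someSucc (Or.inr hn) (over_and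
    (h.mono (insert_subset_insert (subset_insert _ _)))
    (over_neg (over_sub (Or.inr (Or.inl rfl)) (Or.inr (Or.inr (Or.inl rfl))))))))

end OverLemmas

/-! ### Translation of one-step sentences -/

/-- The recursion step of the translation of one-step formulas. -/
def translateStep (k : ℕ) (atom : ℕ → ℕ → WMSO) (m : ℕ) (r₀ r₁ r₂ : WMSO) : WMSO :=
  if m.unpair.1 = 0 then atom m.unpair.2.unpair.1 m.unpair.2.unpair.2
  else if m.unpair.1 = 1 then sub (var k m.unpair.2.unpair.1) (var k m.unpair.2.unpair.2)
  else if m.unpair.1 = 2 then neg r₀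
  else if m.unpair.1 = 3 then or r₁ r₂
  else if m.unpair.1 = 4 then someSucc k m.unpair.2.unpair.1 r₂
  else if m.unpair.1 = 5 then neg (fewSucc k m.unpair.2.unpair.1 r₂)
  else fewSucc k m.unpair.2.unpair.1 (neg r₂)

/-- The translation of the one-step formula with code `m`, interpreted at the successors of the
current node; `atom b x` says that the predicate `b` holds of the variable `x`. -/
def translate (k : ℕ) (atom : ℕ → ℕ → WMSO) (m : ℕ) : WMSO :=
  treeFold (translateStep k atom) m

section Translate

variable {k n : ℕ} {atom : ℕ → ℕ → WMSO}

theorem translate_pred (b : Fin n) (x : ℕ) :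
    translate k atom (OneStep.pred b x).code = atom b x := by
  rw [translate, treeFold]; simp [translateStep, OneStep.code]

theorem translate_eq (x y : ℕ) :
    translate k atom (OneStep.eq x y : OneStep (Fin n)).code = sub (var k x) (var k y) := by
  rw [translate, treeFold]; simp [translateStep, OneStep.code]

theorem translate_neg (φ : OneStep (Fin n)) :
    translate k atom φ.neg.code = neg (translate k atom φ.code) := by
  rw [translate, OneStep.code, treeFold_pair _ (by omega)]; simp [translateStep, translate]

theorem translate_or (φ ψ : OneStep (Fin n)) :
    translate k atom (φ.or ψ).code = or (translate k atom φ.code) (translate k atom ψ.code) := by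
  rw [translate, OneStep.code, treeFold_pair _ (by omega)]; simp [translateStep, translate]

theorem translate_ex (x : ℕ) (φ : OneStep (Fin n)) :
    translate k atom (OneStep.ex x φ).code = someSucc k x (translate k atom φ.code) := by
  rw [translate, OneStep.code, treeFold_pair _ (by omega)]; simp [translateStep, translate]

theorem translate_exInf (x : ℕ) (φ : OneStep (Fin n)) :
    translate k atom (OneStep.exInf x φ).code =
      neg (fewSucc k x (translate k atom φ.code)) := by
  rw [translate, OneStep.code, treeFold_pair _ (by omega)]; simp [translateStep, translate]

theorem translate_allInf (x : ℕ) (φ : OneStep (Fin n)) :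
    translate k atom (OneStep.allInf x φ).code =
      fewSucc k x (neg (translate k atom φ.code)) := by
  rw [translate, OneStep.code, treeFold_pair _ (by omega)]; simp [translateStep, translate]

/-- Correctness of the translation. The predicate `P` collects what the atoms need to know about
the valuation; it must be stable under the changes that the quantifiers make. -/
theorem sat_translate {T : Type u} {R : T → T → Prop} {root s : T} {V : Fin n → Set {t // R s t}}
    {P : (ℕ → Set T) → Prop} (hnode : ∀ ν, P ν → ν (node k) = {s})
    (hfew : ∀ ν X, P ν → P (Function.update ν (few k) X))
    (hvar : ∀ ν x X, P ν → P (Function.update ν (var k x) X))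
    (hatom : ∀ ν (b : Fin n) x (d : {t // R s t}), P ν → ν (var k x) = {(d : T)} →
      (Sat R root ν (atom b x) ↔ d ∈ V b))
    (φ : OneStep (Fin n)) {g : ℕ → {t // R s t}} {ν : ℕ → Set T} (hν : P ν)
    (hg : ∀ x ∈ φ.free, ν (var k x) = {(g x : T)}) :
    Sat R root ν (translate k atom φ.code) ↔ φ.Sat V g := by
  have key : ∀ {φ : OneStep (Fin n)} {x : ℕ} {g : ℕ → {t // R s t}} {ν : ℕ → Set T},
      (∀ y ∈ φ.free.erase x, ν (var k y) = {(g y : T)}) → ∀ d : {t // R s t}, ∀ y ∈ φ.free,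
      Function.update ν (var k x) {(d : T)} (var k y) = {(Function.update g x d y : T)} := by
    intro φ x g ν h d y hy
    by_cases hyx : y = x
    · subst hyx; simp
    · rw [Function.update_of_ne (mt var_inj.1 hyx), Function.update_of_ne hyx,
        h y (Finset.mem_erase.2 ⟨hyx, hy⟩)]
  have key' : ∀ {φ : OneStep (Fin n)} {x : ℕ} {g : ℕ → {t // R s t}} {ν : ℕ → Set T},
      (∀ y ∈ φ.free.erase x, ν (var k y) = {(g y : T)}) → ∀ X,
      ∀ y ∈ φ.free.erase x, Function.update ν (few k) X (var k y) = {(g y : T)} := by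
    intro φ x g ν h X y hy
    rw [Function.update_of_ne (var_ne_few k y), h y hy]
  induction φ generalizing g ν with
  | pred b x =>
    rw [translate_pred]
    exact hatom ν b x (g x) hν (hg x (by simp [OneStep.free]))
  | eq x y =>
    rw [translate_eq, sat_sub, hg x (by simp [OneStep.free]), hg y (by simp [OneStep.free])]
    simp [OneStep.Sat, Subtype.ext_iff]
  | neg φ ih => rw [translate_neg]; exact not_congr (ih hν hg)
  | or φ ψ ih ih' =>
    rw [translate_or]
    exact or_congr (ih hν fun x hx => hg x (Finset.mem_union_left _ hx))
      (ih' hν fun x hx => hg x (Finset.mem_union_right _ hx))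
  | ex x φ ih =>
    rw [translate_ex, sat_someSucc (hnode ν hν)]
    exact exists_congr fun d => ih (hvar ν x _ hν) (key hg d)
  | exInf x φ ih =>
    rw [translate_exInf, sat_neg, sat_fewSucc (hnode ν hν)
      fun X (d : {t // R s t}) => ih (hvar _ x _ (hfew ν X hν)) (key (key' hg X) d)]
    rfl
  | allInf x φ ih =>
    rw [translate_allInf]
    exact sat_fewSucc (hnode ν hν) (φ := neg (translate k atom φ.code))
      (P := fun d => ¬ φ.Sat V (Function.update g x d))
      fun X d => not_congr (ih (hvar _ x _ (hfew ν X hν)) (key (key' hg X) d))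

theorem over_translate {S₀ : Set ℕ} (hn : node k ∈ S₀)
    (hatom : ∀ (b : Fin n) x S, S₀ ⊆ S → var k x ∈ S → Over k S (atom b x))
    (φ : OneStep (Fin n)) {S : Set ℕ} (hS : S₀ ⊆ S) (hfree : ∀ x ∈ φ.free, var k x ∈ S) :
    Over k S (translate k atom φ.code) := by
  have key : ∀ {φ : OneStep (Fin n)} {x : ℕ} {S : Set ℕ},
      (∀ y ∈ φ.free.erase x, var k y ∈ S) → ∀ y ∈ φ.free, var k y ∈ insert (var k x) S := by
    intro φ x S h y hy
    by_cases hyx : y = x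
    · exact Or.inl (by rw [hyx])
    · exact Or.inr (h y (Finset.mem_erase.2 ⟨hyx, hy⟩))
  induction φ generalizing S with
  | pred b x => rw [translate_pred]; exact hatom b x S hS (hfree x (by simp [OneStep.free]))
  | eq x y =>
    rw [translate_eq]
    exact over_sub (Or.inr (hfree x (by simp [OneStep.free])))
      (Or.inr (hfree y (by simp [OneStep.free])))
  | neg φ ih => rw [translate_neg]; exact over_neg (ih hS hfree)
  | or φ ψ ih ih' =>
    rw [translate_or]
    exact over_or (ih hS fun x hx => hfree x (Finset.mem_union_left _ hx))
      (ih' hS fun x hx => hfree x (Finset.mem_union_right _ hx))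
  | ex x φ ih =>
    rw [translate_ex]
    exact over_someSucc (hS hn) (ih (hS.trans (subset_insert _ _)) (key hfree))
  | exInf x φ ih =>
    rw [translate_exInf]
    exact over_neg (over_fewSucc (hS hn) (ih (hS.trans (subset_insert _ _)) (key hfree)))
  | allInf x φ ih =>
    rw [translate_allInf]
    exact over_fewSucc (hS hn) (over_neg (ih (hS.trans (subset_insert _ _)) (key hfree)))

end Translate

end WMSO

/-! ### The formula of an automaton -/

/-- The recursion step that decides whether the predicate `b` occurs in a one-step formula. -/
def occursStep (b m : ℕ) (r₀ r₁ r₂ : Bool) : Bool :=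
  if m.unpair.1 = 0 then decide (m.unpair.2.unpair.1 = b)
  else if m.unpair.1 = 1 then false
  else if m.unpair.1 = 2 then r₀
  else if m.unpair.1 = 3 then r₁ || r₂
  else r₂

/-- The predicate `b` occurs in the one-step formula with code `m`. -/
def occurs (b m : ℕ) : Bool := treeFold (occursStep b) m

theorem occurs_code {n : ℕ} (b : Fin n) (φ : OneStep (Fin n)) :
    occurs b φ.code = true ↔ b ∈ φ.occ := by
  induction φ with
  | pred a x =>
    rw [occurs, treeFold]
    simp [occursStep, OneStep.code, OneStep.occ, Fin.ext_iff, eq_comm]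
  | eq x y => rw [occurs, treeFold]; simp [occursStep, OneStep.code, OneStep.occ]
  | neg φ ih =>
    rw [occurs, OneStep.code, treeFold_pair _ (by omega)]
    simpa [occursStep, occurs, OneStep.occ] using ih
  | or φ ψ ih ih' =>
    rw [occurs, OneStep.code, treeFold_pair _ (by omega)]
    simpa [occursStep, occurs, OneStep.occ] using or_congr ih ih'
  | ex x φ ih =>
    rw [occurs, OneStep.code, treeFold_pair _ (by omega)]
    simpa [occursStep, occurs, OneStep.occ] using ih
  | exInf x φ ih =>
    rw [occurs, OneStep.code, treeFold_pair _ (by omega)]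
    simpa [occursStep, occurs, OneStep.occ] using ih
  | allInf x φ ih =>
    rw [occurs, OneStep.code, treeFold_pair _ (by omega)]
    simpa [occursStep, occurs, OneStep.occ] using ih

/-- Presentations of automata: the number of letters, the number of states, the initial state,
the priorities, and the table of the codes of the one-step sentences. -/
abbrev Presentation : Type := ℕ × ℕ × ℕ × List ℕ × List (List ℕ)

namespace Presentation

open WMSO

/-- The priority of the state `a`. -/
def priority (i : Presentation) (a : ℕ) : ℕ := i.2.2.2.1.getD a 0

/-- The code of the one-step sentence of the state `a` at the colour with number `m`. -/
def entry (i : Presentation) (a m : ℕ) : ℕ := (i.2.2.2.2.getD a []).getD m 0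

/-- The state `b` occurs in a one-step sentence of the state `a`. -/
def Edge (i : Presentation) (a b : ℕ) : Prop := ∃ m < 2 ^ i.1, occurs b (entry i a m) = true

/-- The state `b` is reachable from the state `a`: it belongs to all sets of states that contain
`a` and are closed under edges. Sets of states are coded as binary numbers. -/
def Reaches (i : Presentation) (a b : ℕ) : Prop :=
  ∀ S < 2 ^ i.2.1, S.testBit a = true → (∀ c < i.2.1, ∀ d < i.2.1, Edge i c d →
    S.testBit c = true → S.testBit d = true) → S.testBit b = true

/-- The states `a` and `b` are in the same cluster. -/
def Together (i : Presentation) (a b : ℕ) : Prop := Reaches i a b ∧ Reaches i b a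

open Classical in
/-- The variable `x` belongs to the state `b`, in the scope of the fixpoint for the cluster of
`a`: states of the cluster are interpreted by the current approximation (or by its complement,
for an even cluster), all others by the formulas `prev`. -/
noncomputable def atom (i : Presentation) (a : ℕ) (prev : List WMSO) (b x : ℕ) : WMSO :=
  if Together i a b then
    if priority i a % 2 = 1 then sub (var i.1 x) (state i.1 b)
    else neg (sub (var i.1 x) (state i.1 b))
  else ex (node i.1) (and (sub (node i.1) (var i.1 x)) (and (sub (var i.1 x) (node i.1))
    (prev.getD b (top (node i.1)))))

/-- The letter `p` has the truth value at the current node that the colour `m` prescribes. -/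
def literal (k m p : ℕ) : WMSO :=
  if m.testBit p = true then sub (node k) p else neg (sub (node k) p)

/-- The current node has the colour with number `m`. -/
def hasColour (k m : ℕ) : WMSO := bigAnd (node k) ((List.range k).map (literal k m))

/-- The one-step sentence of the state `b` holds at the current node. -/
noncomputable def oneStep (i : Presentation) (a : ℕ) (prev : List WMSO) (b : ℕ) : WMSO :=
  bigOr (node i.1) ((List.range (2 ^ i.1)).map fun m =>
    and (hasColour i.1 m) (translate i.1 (atom i a prev) (entry i b m)))

open Classical in
/-- The current approximation is closed at the state `b`, relative to the set `box`, under the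
operator of the cluster of `a`. -/
noncomputable def closed (i : Presentation) (a : ℕ) (prev : List WMSO) (b : ℕ) : WMSO :=
  if Together i a b then
    neg (ex (node i.1) (and (single i.1 (node i.1)) (and (sub (node i.1) (box i.1))
      (and (if priority i a % 2 = 1 then oneStep i a prev b else neg (oneStep i a prev b))
        (neg (sub (node i.1) (state i.1 b)))))))
  else top (node i.1)

/-- The current node belongs to the least fixpoint of the operator of the cluster of `a`. -/
noncomputable def fixpoint (i : Presentation) (a : ℕ) (prev : List WMSO) : WMSO :=
  ex (box i.1) (and (sub (node i.1) (box i.1))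
    (neg (exs ((List.range i.2.1).map (state i.1))
      (and (bigAnd (node i.1) ((List.range i.2.1).map (closed i a prev)))
        (neg (sub (node i.1) (state i.1 a)))))))

/-- The formulas for acceptance from the states, given those for the lower clusters. -/
noncomputable def nextLevel (i : Presentation) (prev : List WMSO) : List WMSO :=
  (List.range i.2.1).map fun a =>
    if priority i a % 2 = 1 then fixpoint i a prev else neg (fixpoint i a prev)

/-- The formula of the automaton that is presented by `i`. -/
noncomputable def formula (i : Presentation) : WMSO :=
  ex (node i.1) (and (here (node i.1))
    (((nextLevel i)^[i.2.1] []).getD i.2.2.1 (top (node i.1))))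

end Presentation

namespace ParityAutomaton

open WMSO Presentation

variable {k : ℕ} {𝔸 : ParityAutomaton k} {T : Type u} {M : LTS k T}

theorem priority_code (a : Fin 𝔸.n) : priority 𝔸.code a = 𝔸.Ω a := by
  simp [priority, code]

theorem entry_code (a : Fin 𝔸.n) {m : ℕ} (hm : m < 2 ^ k) :
    entry 𝔸.code a m = (𝔸.Δ a (colour k m)).code := by
  simp [entry, code, hm]

theorem edge_code (a b : Fin 𝔸.n) :
    Edge 𝔸.code a b ↔ ∃ c, b ∈ (𝔸.Δ a c).occ := by
  constructor
  · rintro ⟨m, hm, h⟩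
    rw [entry_code a hm, occurs_code] at h
    exact ⟨_, h⟩
  · rintro ⟨c, hc⟩
    obtain ⟨m, rfl⟩ := colour_surjective k c
    exact ⟨m, m.2, by rwa [entry_code a m.2, occurs_code]⟩

theorem reaches_code (a b : Fin 𝔸.n) : Reaches 𝔸.code a b ↔ 𝔸.Reach a b := by
  classical
  constructor
  · intro h
    -- the set of all states reachable from `a` is one of the closed sets
    let S : ℕ := Nat.ofBits fun c : Fin 𝔸.n => decide (𝔸.Reach a c)
    have hS : ∀ c : Fin 𝔸.n, S.testBit c = true ↔ 𝔸.Reach a c := fun c => by simp [S]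
    refine (hS b).1 (h S (Nat.ofBits_lt_two_pow _) ((hS a).2 Relation.ReflTransGen.refl) ?_)
    intro c hc d hd hE hcS
    exact (hS ⟨d, hd⟩).2 (((hS ⟨c, hc⟩).1 hcS).tail ((edge_code ⟨c, hc⟩ ⟨d, hd⟩).1 hE))
  · intro h S _ haS hclosed
    induction h with
    | refl => exact haS
    | tail _ hE ih => exact hclosed _ (Fin.is_lt _) _ (Fin.is_lt _) ((edge_code _ _).2 hE) ih

theorem together_code (a b : Fin 𝔸.n) : Together 𝔸.code a b ↔ 𝔸.SameCluster a b :=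
  and_congr (reaches_code a b) (reaches_code b a)

section Semantics

variable {root : T} {ν : ℕ → Set T} {s : T}

theorem sat_hasColour (hν : ∀ p < k, ν p = M.val p) (hs : ν (node k) = {s}) {m : ℕ} :
    Sat M.R root ν (hasColour k m) ↔ colour k m = M.σ s := by
  have hlit : ∀ p : Fin k, Sat M.R root ν (literal k m p) ↔
      (p ∈ colour k m ↔ p ∈ M.σ s) := by
    intro p
    have hp : ν (node k) ⊆ ν p ↔ p ∈ M.σ s := by
      rw [hs, hν p p.2]
      simp [LTS.val]
    by_cases hm : m.testBit p = true
    · simp [literal, hm, sat_sub, hp, colour]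
    · simp [literal, hm, sat_neg, sat_sub, hp, colour]
  rw [hasColour, sat_bigAnd]
  simp only [List.mem_map, List.mem_range, forall_exists_index, and_imp,
    forall_apply_eq_imp_iff₂, Finset.ext_iff]
  exact ⟨fun h p => (hlit p).1 (h p p.2), fun h p hp => (hlit ⟨p, hp⟩).2 (h ⟨p, hp⟩)⟩

open Classical in
variable (𝔸) in
/-- The valuation of the states for an approximation `Y` of the fixpoint of a cluster. -/
noncomputable def approx (a : Fin 𝔸.n) (Y W : Fin 𝔸.n → Set T) : Fin 𝔸.n → Set T :=
  if Odd (𝔸.Ω a) then 𝔸.hybrid a Y W else 𝔸.hybrid a (fun c => (Y c)ᶜ) W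

variable {prev : List WMSO} {W Y : Fin 𝔸.n → Set T}
  (hprev : ∀ b : Fin 𝔸.n, ∀ ν : ℕ → Set T, (∀ p < k, ν p = M.val p) → ∀ s, ν (node k) = {s} →
    (Sat M.R root ν (prev.getD b (top (node k))) ↔ s ∈ W b))

include hprev

theorem sat_atom (hν : ∀ p < k, ν p = M.val p) (hY : ∀ b : Fin 𝔸.n, ν (state k b) = Y b)
    (a b : Fin 𝔸.n) (x : ℕ) (d : T) (hd : ν (var k x) = {d}) :
    Sat M.R root ν (atom 𝔸.code a prev b x) ↔ d ∈ 𝔸.approx a Y W b := by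
  have hk : 𝔸.code.1 = k := rfl
  simp only [atom, priority_code, hk, ← Nat.odd_iff, approx]
  by_cases hab : 𝔸.SameCluster a b
  · rw [if_pos ((together_code a b).2 hab)]
    by_cases ho : Odd (𝔸.Ω a)
    · simp [hab, ho, sat_sub, hd, hY, hybrid]
    · simp [hab, ho, sat_sub, sat_neg, hd, hY, hybrid]
  · have hW : d ∈ (if Odd (𝔸.Ω a) then 𝔸.hybrid a Y W else
        𝔸.hybrid a (fun c => (Y c)ᶜ) W) b ↔ d ∈ W b := by
      split_ifs <;> simp [hybrid, hab]
    rw [hW, if_neg (mt (together_code a b).1 hab)]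
    simp only [sat_ex, sat_and, sat_sub, Function.update_self,
      Function.update_of_ne (node_ne_var k x).symm, hd]
    have hν' : ∀ p < k, Function.update ν (node k) {d} p = M.val p := fun p hp => by
      rw [Function.update_of_ne (by unfold node; omega), hν p hp]
    constructor
    · rintro ⟨X, -, h1, h2, h⟩
      obtain rfl : X = {d} := Subset.antisymm h1 h2
      exact (hprev b _ hν' d (Function.update_self ..)).1 h
    · exact fun h => ⟨{d}, finite_singleton d, Subset.rfl, Subset.rfl,
        (hprev b _ hν' d (Function.update_self ..)).2 h⟩

theorem sat_oneStep (hν : ∀ p < k, ν p = M.val p) (hs : ν (node k) = {s})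
    (hY : ∀ b : Fin 𝔸.n, ν (state k b) = Y b) (a b : Fin 𝔸.n) :
    Sat M.R root ν (oneStep 𝔸.code a prev b) ↔ 𝔸.Step M b (𝔸.approx a Y W) s := by
  have hk : 𝔸.code.1 = k := rfl
  obtain ⟨t₀, ht₀⟩ := M.serial s
  let g : ℕ → {t // M.R s t} := fun _ => ⟨t₀, ht₀⟩
  have htr : ∀ c, Sat M.R root ν (translate k (atom 𝔸.code a prev) (𝔸.Δ b c).code) ↔
      (𝔸.Δ b c).Sat (fun b => {d : {t // M.R s t} | (d : T) ∈ 𝔸.approx a Y W b}) g := by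
    intro c
    refine sat_translate (P := fun ν => (∀ p < k, ν p = M.val p) ∧ ν (node k) = {s} ∧
      ∀ b : Fin 𝔸.n, ν (state k b) = Y b) (fun ν h => h.2.1) (fun ν X h => ?_)
      (fun ν x X h => ?_) (fun ν b x d h hd => sat_atom hprev h.1 h.2.2 a b x d hd) _
      ⟨hν, hs, hY⟩ (by simp [𝔸.sentence])
    · refine ⟨fun p hp => ?_, ?_, fun b => ?_⟩
      · rw [Function.update_of_ne (by unfold few; omega), h.1 p hp]
      · rw [Function.update_of_ne (node_ne_few k), h.2.1]
      · rw [Function.update_of_ne (state_ne_few k b), h.2.2 b]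
    · refine ⟨fun p hp => ?_, ?_, fun b => ?_⟩
      · rw [Function.update_of_ne (by unfold var; omega), h.1 p hp]
      · rw [Function.update_of_ne (node_ne_var k x), h.2.1]
      · rw [Function.update_of_ne (state_ne_var k b x), h.2.2 b]
  rw [step_iff g, ← htr, oneStep, sat_bigOr]
  simp only [hk, List.mem_map, List.mem_range, exists_exists_and_eq_and, sat_and,
    sat_hasColour hν hs]
  constructor
  · rintro ⟨m, hm, hc, h⟩
    rwa [entry_code b hm, hc] at h
  · intro h
    obtain ⟨m, hm⟩ := colour_surjective k (M.σ s)
    exact ⟨m, m.2, hm, by rwa [entry_code b m.2, hm]⟩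

/-- The formula `closed` expresses closure under the operator of the cluster, relative to the value
of the letter `box`. -/
theorem sat_closed (hν : ∀ p < k, ν p = M.val p)
    (hY : ∀ b : Fin 𝔸.n, ν (state k b) = Y b) (a b : Fin 𝔸.n) :
    Sat M.R root ν (closed 𝔸.code a prev b) ↔
      ∀ t ∈ ν (box k), t ∈ 𝔸.clusterOp M a W Y b → t ∈ Y b := by
  have hk : 𝔸.code.1 = k := rfl
  simp only [closed, priority_code, hk, ← Nat.odd_iff]
  by_cases hab : 𝔸.SameCluster a b
  · have hop : ∀ t, Sat M.R root (Function.update ν (node k) {t})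
        (if Odd (𝔸.Ω a) then oneStep 𝔸.code a prev b else neg (oneStep 𝔸.code a prev b)) ↔
        t ∈ 𝔸.clusterOp M a W Y b := by
      intro t
      have h := sat_oneStep hprev (ν := Function.update ν (node k) {t}) (s := t) (Y := Y)
        (fun p hp => by rw [Function.update_of_ne (by unfold node; omega), hν p hp])
        (Function.update_self ..)
        (fun b => by rw [Function.update_of_ne (state_ne_node k b), hY b]) a b
      by_cases ho : Odd (𝔸.Ω a)
      · rw [if_pos ho, h]
        simp [approx, ho, clusterOp, hab, Nat.not_even_iff_odd.2 ho]
      · rw [if_neg ho, sat_neg, h]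
        simp [approx, ho, clusterOp, hab, Nat.not_odd_iff_even.1 ho]
    rw [if_pos ((together_code a b).2 hab)]
    simp only [sat_neg, sat_ex, sat_and, sat_sub, sat_single (node_ne_aux k) (node_ne_aux' k),
      Function.update_self, Function.update_of_ne (box_ne_node k),
      Function.update_of_ne (state_ne_node k b), hY]
    constructor
    · intro h t ht hop'
      by_contra hno
      exact h ⟨{t}, finite_singleton t, ⟨t, rfl⟩, singleton_subset_iff.2 ht, (hop t).2 hop',
        fun h' => hno (singleton_subset_iff.1 h')⟩
    · rintro h ⟨X, -, ⟨t, rfl⟩, ht, hop', hno⟩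
      exact hno (singleton_subset_iff.2 (h t (singleton_subset_iff.1 ht) ((hop t).1 hop')))
  · rw [if_neg (mt (together_code a b).1 hab)]
    exact ⟨fun _ t _ ht => absurd ht.1 hab, fun _ => sat_top⟩

/-- The formula `fixpoint` defines the least fixpoint of the operator of the cluster. -/
theorem sat_fixpoint (h𝔸 : IsContinuousWeak.{u} 𝔸) (hν : ∀ p < k, ν p = M.val p)
    (hs : ν (node k) = {s}) (a : Fin 𝔸.n) :
    Sat M.R root ν (fixpoint 𝔸.code a prev) ↔ ∃ j, s ∈ (𝔸.clusterOp M a W)^[j] ⊥ a := by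
  classical
  have hk : 𝔸.code.1 = k := rfl
  have hn : 𝔸.code.2.1 = 𝔸.n := rfl
  rw [exists_mem_iterate_iff (clusterOp_mono h𝔸 a W) (clusterOp_finitary h𝔸 a W), fixpoint]
  simp only [hk, hn, sat_ex, sat_and, sat_sub, sat_neg, sat_exs, Function.update_self,
    Function.update_of_ne (node_ne_box k), hs, singleton_subset_iff]
  refine exists_congr fun X => and_congr_right fun _ => and_congr_right fun _ => ?_
  have hmem : ∀ b : Fin 𝔸.n, state k b ∈ (List.range 𝔸.n).map (state k) :=
    fun b => List.mem_map.2 ⟨b, List.mem_range.2 b.2, rfl⟩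
  -- a valuation that changes only the letters of the states is a family of finite sets
  have hval : ∀ ν' : ℕ → Set T, (∀ q ∉ (List.range 𝔸.n).map (state k),
      ν' q = Function.update ν (box k) X q) → ∀ Y : Fin 𝔸.n → Set T,
      (∀ b : Fin 𝔸.n, ν' (state k b) = Y b) →
      ((Sat M.R root ν' (bigAnd (node k) ((List.range 𝔸.n).map (closed 𝔸.code a prev))) ∧
        ¬ ν' (node k) ⊆ ν' (state k a)) ↔
      ¬ ((∀ b, ∀ t ∈ X, t ∈ 𝔸.clusterOp M a W Y b → t ∈ Y b) → s ∈ Y a)) := by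
    intro ν' hν' Y hY
    have hbase : ∀ p < k, ν' p = M.val p := fun p hp => by
      rw [hν' p, Function.update_of_ne (by unfold box; omega), hν p hp]
      simp only [List.mem_map, not_exists, not_and]
      rintro b - hb
      unfold state at hb
      omega
    have hnode : ν' (node k) = {s} := by
      rw [hν', Function.update_of_ne (node_ne_box k), hs]
      simp only [List.mem_map, not_exists, not_and]
      exact fun b _ => state_ne_node k b
    have hbox : ν' (box k) = X := by
      rw [hν', Function.update_self]
      simp only [List.mem_map, not_exists, not_and]
      exact fun b _ => (box_ne_state k b).symm
    rw [sat_bigAnd, hnode, hY, singleton_subset_iff, Classical.not_imp]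
    refine and_congr_left fun _ => ?_
    simp only [List.mem_map, List.mem_range, forall_exists_index, and_imp,
      forall_apply_eq_imp_iff₂]
    refine ⟨fun h b => ?_, fun h b hb => ?_⟩
    · exact hbox ▸ (sat_closed hprev hbase hY a b).1 (h b b.2)
    · exact (sat_closed hprev hbase hY a ⟨b, hb⟩).2 (hbox ▸ h ⟨b, hb⟩)
  constructor
  · intro h Y hYf
    by_contra hno
    let ν' : ℕ → Set T := fun q => if hq : ∃ b : Fin 𝔸.n, state k b = q then Y hq.choose
      else Function.update ν (box k) X q
    have hY : ∀ b : Fin 𝔸.n, ν' (state k b) = Y b := by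
      intro b
      have hq : ∃ c : Fin 𝔸.n, state k c = state k b := ⟨b, rfl⟩
      have : hq.choose = b := Fin.ext (state_inj.1 hq.choose_spec)
      simp only [ν', dif_pos hq, this]
    have hν' : ∀ q ∉ (List.range 𝔸.n).map (state k), ν' q = Function.update ν (box k) X q :=
      fun q hq => dif_neg fun ⟨b, hb⟩ => hq (hb ▸ hmem b)
    refine h ⟨ν', hν', fun q hq => ?_, (hval ν' hν' Y hY).2 hno⟩
    obtain ⟨b, hb, rfl⟩ := List.mem_map.1 hq
    exact (hY ⟨b, List.mem_range.1 hb⟩).symm ▸ hYf _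
  · rintro h ⟨ν', hν', hfin, h'⟩
    exact (hval ν' hν' (fun b => ν' (state k b)) fun _ => rfl).1 h'
      (h _ fun b => hfin _ (hmem b))

end Semantics

/-- The `d`-th list of formulas defines the `d`-th approximation of acceptance; since the initial
list is empty, the default value `top` stands for the initial approximation. -/
theorem sat_levels (h𝔸 : IsContinuousWeak.{u} 𝔸) {root : T} (d : ℕ) (a : Fin 𝔸.n)
    (ν : ℕ → Set T) (hν : ∀ p < k, ν p = M.val p) (s : T) (hs : ν (node k) = {s}) :
    Sat M.R root ν (((nextLevel 𝔸.code)^[d] []).getD a (top (node k))) ↔ s ∈ 𝔸.level M d a := by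
  induction d generalizing a ν s with
  | zero => simp [level]
  | succ d ih =>
    have hn : 𝔸.code.2.1 = 𝔸.n := rfl
    have hget : ((nextLevel 𝔸.code)^[d + 1] []).getD a (top (node k)) =
        if priority 𝔸.code a % 2 = 1 then fixpoint 𝔸.code a ((nextLevel 𝔸.code)^[d] [])
        else neg (fixpoint 𝔸.code a ((nextLevel 𝔸.code)^[d] [])) := by
      rw [Function.iterate_succ_apply']
      generalize (nextLevel 𝔸.code)^[d] [] = prev
      simp [nextLevel, hn]
    have hfix := sat_fixpoint (W := 𝔸.level M d) ih h𝔸 hν hs a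
    simp only [hget, priority_code, ← Nat.odd_iff, level, clusterSem]
    by_cases ho : Odd (𝔸.Ω a)
    · simpa [ho] using hfix
    · simpa [ho, sat_neg] using not_congr hfix

theorem trueIn_formula_iff (h𝔸 : IsContinuousWeak.{u} 𝔸) :
    (formula 𝔸.code).TrueIn M ↔ 𝔸.Accepts M := by
  rw [accepts_iff h𝔸]
  have hk : 𝔸.code.1 = k := rfl
  have hn : 𝔸.code.2.1 = 𝔸.n := rfl
  have hstart : 𝔸.code.2.2.1 = 𝔸.start := rfl
  simp only [TrueIn, formula, hk, hn, hstart, sat_ex, sat_and]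
  have key := sat_levels (root := M.root) h𝔸 𝔸.n 𝔸.start
    (Function.update M.val (node k) {M.root})
    (fun p hp => Function.update_of_ne (by unfold node; omega) ..) M.root
    (Function.update_self ..)
  constructor
  · rintro ⟨X, -, hX, h⟩
    obtain rfl : X = {M.root} := by
      have : Function.update M.val (node k) X (node k) = {M.root} := hX
      rwa [Function.update_self] at this
    exact key.1 h
  · exact fun h => ⟨{M.root}, finite_singleton _, Function.update_self .., key.2 h⟩

/-! ### The letters of the formula of an automaton -/

section Over

variable {prev : List WMSO}
  (hprev : ∀ b : Fin 𝔸.n, Over k {node k} (prev.getD b (top (node k))))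

include hprev

theorem over_atom {S : Set ℕ} (a b : Fin 𝔸.n) (x : ℕ) (hb : state k b ∈ S)
    (hx : var k x ∈ S) : Over k S (atom 𝔸.code a prev b x) := by
  have hk : 𝔸.code.1 = k := rfl
  have hn : ∀ S : Set ℕ, node k < k ∨ node k ∈ insert (node k) S := fun S => Or.inr (Or.inl rfl)
  have hx' : var k x < k ∨ var k x ∈ insert (node k) S := Or.inr (Or.inr hx)
  rw [atom, hk]
  split_ifs
  · exact over_sub (Or.inr hx) (Or.inr hb)
  · exact over_neg (over_sub (Or.inr hx) (Or.inr hb))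
  · exact over_ex le_rfl (over_and (over_sub (hn S) hx') (over_and (over_sub hx' (hn S))
      ((hprev b).mono (by simp))))

theorem over_oneStep {S : Set ℕ} (a b : Fin 𝔸.n) (hn : node k ∈ S)
    (hS : ∀ b : Fin 𝔸.n, state k b ∈ S) : Over k S (oneStep 𝔸.code a prev b) := by
  have hk : 𝔸.code.1 = k := rfl
  rw [oneStep, hk]
  refine over_bigOr (Or.inr hn) fun φ hφ => ?_
  obtain ⟨m, hm, rfl⟩ := List.mem_map.1 hφ
  rw [List.mem_range] at hm
  refine over_and (over_bigAnd (Or.inr hn) fun ψ hψ => ?_) ?_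
  · obtain ⟨p, hp, rfl⟩ := List.mem_map.1 hψ
    have h := over_sub (S := S) (Or.inr hn) (Or.inl (List.mem_range.1 hp))
    rw [literal]
    split_ifs
    exacts [h, over_neg h]
  · rw [entry_code b hm]
    exact over_translate hn (fun c x S' hS' hx => over_atom hprev a c x (hS' (hS c)) hx) _
      Subset.rfl (by simp [𝔸.sentence])

theorem over_fixpoint (a : Fin 𝔸.n) :
    Over k {node k} (fixpoint 𝔸.code a prev) := by
  have hk : 𝔸.code.1 = k := rfl
  have hN : 𝔸.code.2.1 = 𝔸.n := rfl
  rw [fixpoint, hk, hN]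
  have hstate : ∀ b : Fin 𝔸.n, ∀ S : Set ℕ,
      state k b ∈ S ∪ {q | q ∈ (List.range 𝔸.n).map (state k)} :=
    fun b S => Or.inr (List.mem_map.2 ⟨b, List.mem_range.2 b.2, rfl⟩)
  refine over_ex (le_box k) (over_and
    (over_sub (Or.inr (Or.inr rfl)) (Or.inr (Or.inl rfl))) (over_neg (over_exs ?_ (over_and
      (over_bigAnd (Or.inr (Or.inl (Or.inr rfl))) fun φ hφ => ?_)
      (over_neg (over_sub (Or.inr (Or.inl (Or.inr rfl))) (Or.inr (hstate a _))))))))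
  · intro q hq
    obtain ⟨b, -, rfl⟩ := List.mem_map.1 hq
    exact le_state k b
  · obtain ⟨b, hb, rfl⟩ := List.mem_map.1 hφ
    rw [List.mem_range] at hb
    rw [closed, hk]
    by_cases hab : Together 𝔸.code a b
    · rw [if_pos hab]
      have hn : ∀ S : Set ℕ, node k < k ∨ node k ∈ insert (node k) S :=
        fun S => Or.inr (Or.inl rfl)
      have hstep := over_oneStep hprev (S := insert (node k) (insert (box k) {node k} ∪
        {q | q ∈ (List.range 𝔸.n).map (state k)})) a ⟨b, hb⟩ (Or.inl rfl)
        (fun c => Or.inr (hstate c _))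
      refine over_neg (over_ex le_rfl (over_and (over_single (hn _)) (over_and
        (over_sub (hn _) (Or.inr (Or.inr (Or.inl (Or.inl rfl))))) (over_and ?_
          (over_neg (over_sub (hn _) (Or.inr (Or.inr (hstate ⟨b, hb⟩ _)))))))))
      split_ifs
      exacts [hstep, over_neg hstep]
    · rw [if_neg hab]
      exact over_top (Or.inr (Or.inl (Or.inr rfl)))

end Over

theorem over_levels (d : ℕ) (a : Fin 𝔸.n) :
    Over k {node k} (((nextLevel 𝔸.code)^[d] []).getD a (top (node k))) := by
  induction d generalizing a with
  | zero => exact over_top (Or.inr rfl)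
  | succ d ih =>
    have hN : 𝔸.code.2.1 = 𝔸.n := rfl
    rw [Function.iterate_succ_apply']
    revert ih
    generalize (nextLevel 𝔸.code)^[d] [] = prev
    intro ih
    have h := over_fixpoint ih a
    simp only [nextLevel, hN, List.getD_eq_getElem?_getD, List.getElem?_map, a.2,
      List.getElem?_range, Option.map_some, Option.getD_some]
    split_ifs
    exacts [h, over_neg h]

theorem isOver_formula : (formula 𝔸.code).IsOver k :=
  Over.isOver (over_ex le_rfl (over_and (over_here (Or.inr (Or.inl rfl)))
    ((over_levels 𝔸.n 𝔸.start).mono (by simp [show 𝔸.code.1 = k from rfl]))))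

end ParityAutomaton

/-! ### Computability of the formula of an automaton -/

theorem primrec_two_pow : Primrec fun n : ℕ => 2 ^ n :=
  (Primrec₂.unpaired'.1 Nat.Primrec.pow).comp (Primrec.const 2) Primrec.id

theorem primrec_testBit : Primrec₂ Nat.testBit := by
  have h : PrimrecPred fun p : ℕ × ℕ => p.1 / 2 ^ p.2 % 2 = 1 :=
    Primrec.eq.comp (Primrec.nat_mod.comp (Primrec.nat_div.comp Primrec.fst
      (primrec_two_pow.comp Primrec.snd)) (Primrec.const 2)) (Primrec.const 1)
  exact h.decide.of_eq fun p => (Nat.testBit_eq_decide_div_mod_eq ..).symm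

theorem PrimrecPred.imp {α : Type*} [Primcodable α] {p q : α → Prop} (hp : PrimrecPred p)
    (hq : PrimrecPred q) : PrimrecPred fun a => p a → q a :=
  (hp.not.or hq).of_eq fun _ => imp_iff_not_or.symm

section

variable {α : Type} [Primcodable α]

theorem primrecPred_forall_lt {R : ℕ → α → Prop} (hR : PrimrecRel R) {n : α → ℕ}
    (hn : Primrec n) : PrimrecPred fun t => ∀ x < n t, R x t :=
  (hR.forall_mem_list.comp (Primrec.list_range.comp hn) Primrec.id).of_eq fun _ => by simp

theorem primrecPred_exists_lt {R : ℕ → α → Prop} (hR : PrimrecRel R) {n : α → ℕ}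
    (hn : Primrec n) : PrimrecPred fun t => ∃ x < n t, R x t :=
  (hR.exists_mem_list.comp (Primrec.list_range.comp hn) Primrec.id).of_eq fun _ => by simp

namespace WMSO

variable {k p x m : α → ℕ} {φ ψ : α → WMSO} {l : α → List WMSO}

theorem primrec_add_const (c : ℕ) (hk : Primrec k) : Primrec fun a => k a + c :=
  Primrec.nat_add.comp hk (Primrec.const c)

theorem primrec_var (hk : Primrec k) (hx : Primrec x) : Primrec fun a => var (k a) (x a) :=
  Primrec.nat_add.comp (primrec_add_const 5 hk) (Primrec.nat_mul.comp (Primrec.const 2) hx)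

theorem primrec_state (hk : Primrec k) (hx : Primrec x) : Primrec fun a => state (k a) (x a) :=
  Primrec.nat_add.comp (primrec_add_const 6 hk) (Primrec.nat_mul.comp (Primrec.const 2) hx)

theorem primrec_and : Primrec₂ and :=
  primrec_neg.comp₂ (primrec_or.comp₂ (primrec_neg.comp₂ Primrec₂.left)
    (primrec_neg.comp₂ Primrec₂.right))

theorem primrec_top (hp : Primrec p) : Primrec fun a => top (p a) := primrec_sub.comp hp hp

theorem primrec_bigAnd (hp : Primrec p) (hl : Primrec l) :
    Primrec fun a => bigAnd (p a) (l a) :=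
  Primrec.list_foldr hl (primrec_top hp)
    (primrec_and.comp (Primrec.fst.comp Primrec.snd) (Primrec.snd.comp Primrec.snd)).to₂

theorem primrec_bigOr (hp : Primrec p) (hl : Primrec l) :
    Primrec fun a => bigOr (p a) (l a) :=
  Primrec.list_foldr hl (primrec_neg.comp (primrec_top hp))
    (primrec_or.comp (Primrec.fst.comp Primrec.snd) (Primrec.snd.comp Primrec.snd)).to₂

theorem primrec_exs {l : α → List ℕ} (hl : Primrec l) (hφ : Primrec φ) :
    Primrec fun a => exs (l a) (φ a) :=
  Primrec.list_foldr hl hφ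
    (primrec_ex.comp (Primrec.fst.comp Primrec.snd) (Primrec.snd.comp Primrec.snd)).to₂

theorem primrec_nonempty (hk : Primrec k) (hp : Primrec p) :
    Primrec fun a => nonempty (k a) (p a) :=
  have h : Primrec fun a => aux' (k a) := primrec_add_const 3 hk
  primrec_ex.comp h (primrec_neg.comp (primrec_sub.comp hp h))

theorem primrec_single (hk : Primrec k) (hp : Primrec p) :
    Primrec fun a => single (k a) (p a) :=
  have h : Primrec fun a => aux (k a) := primrec_add_const 2 hk
  primrec_and.comp (primrec_nonempty hk hp) (primrec_neg.comp (primrec_ex.comp h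
    (primrec_and.comp (primrec_sub.comp h hp) (primrec_and.comp (primrec_nonempty hk h)
      (primrec_neg.comp (primrec_sub.comp hp h))))))

theorem primrec_someSucc (hk : Primrec k) (hx : Primrec x) (hφ : Primrec φ) :
    Primrec fun a => someSucc (k a) (x a) (φ a) :=
  have h := primrec_var hk hx
  primrec_ex.comp h (primrec_and.comp (primrec_single hk h)
    (primrec_and.comp (primrec_rel.comp hk h) hφ))

theorem primrec_fewSucc (hk : Primrec k) (hx : Primrec x) (hφ : Primrec φ) :
    Primrec fun a => fewSucc (k a) (x a) (φ a) :=
  have h : Primrec fun a => few (k a) := primrec_add_const 1 hk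
  primrec_ex.comp h (primrec_neg.comp (primrec_someSucc hk hx (primrec_and.comp hφ
    (primrec_neg.comp (primrec_sub.comp (primrec_var hk hx) h)))))

theorem primrec_translate {atom : α → ℕ → ℕ → WMSO} (hk : Primrec k)
    (hatom : Primrec fun q : α × ℕ × ℕ => atom q.1 q.2.1 q.2.2) (hm : Primrec m) :
    Primrec fun a => translate (k a) (atom a) (m a) := by
  have hm' : Primrec fun q : α × ℕ × WMSO × WMSO × WMSO => q.2.1 :=
    Primrec.fst.comp Primrec.snd
  have h0 : Primrec fun q : α × ℕ × WMSO × WMSO × WMSO => q.2.2.1 :=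
    Primrec.fst.comp (Primrec.snd.comp Primrec.snd)
  have h1 : Primrec fun q : α × ℕ × WMSO × WMSO × WMSO => q.2.2.2.1 :=
    Primrec.fst.comp (Primrec.snd.comp (Primrec.snd.comp Primrec.snd))
  have h2 : Primrec fun q : α × ℕ × WMSO × WMSO × WMSO => q.2.2.2.2 :=
    Primrec.snd.comp (Primrec.snd.comp (Primrec.snd.comp Primrec.snd))
  have hk' : Primrec fun q : α × ℕ × WMSO × WMSO × WMSO => k q.1 := hk.comp Primrec.fst
  have htag := Primrec.fst.comp (Primrec.unpair.comp hm')
  have hpair := Primrec.unpair.comp (Primrec.snd.comp (Primrec.unpair.comp hm'))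
  have hl := Primrec.fst.comp hpair
  have hr := Primrec.snd.comp hpair
  have heq : ∀ c, PrimrecPred fun q : α × ℕ × WMSO × WMSO × WMSO => q.2.1.unpair.1 = c :=
    fun c => Primrec.eq.comp htag (Primrec.const c)
  have hstep : Primrec fun q : α × ℕ × WMSO × WMSO × WMSO =>
      translateStep (k q.1) (atom q.1) q.2.1 q.2.2.1 q.2.2.2.1 q.2.2.2.2 :=
    Primrec.ite (heq 0) (hatom.comp (Primrec.fst.pair (hl.pair hr)))
      (Primrec.ite (heq 1) (primrec_sub.comp (primrec_var hk' hl) (primrec_var hk' hr))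
      (Primrec.ite (heq 2) (primrec_neg.comp h0)
      (Primrec.ite (heq 3) (primrec_or.comp h1 h2)
      (Primrec.ite (heq 4) (primrec_someSucc hk' hl h2)
      (Primrec.ite (heq 5) (primrec_neg.comp (primrec_fewSucc hk' hl h2))
        (primrec_fewSucc hk' hl (primrec_neg.comp h2)))))))
  exact (Primrec.treeFold (g := fun a => translateStep (k a) (atom a)) hstep).comp
    Primrec.id hm

end WMSO

theorem primrec_occurs : Primrec₂ occurs := by
  have hm : Primrec fun q : ℕ × ℕ × Bool × Bool × Bool => q.2.1 := Primrec.fst.comp Primrec.snd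
  have h0 : Primrec fun q : ℕ × ℕ × Bool × Bool × Bool => q.2.2.1 :=
    Primrec.fst.comp (Primrec.snd.comp Primrec.snd)
  have h1 : Primrec fun q : ℕ × ℕ × Bool × Bool × Bool => q.2.2.2.1 :=
    Primrec.fst.comp (Primrec.snd.comp (Primrec.snd.comp Primrec.snd))
  have h2 : Primrec fun q : ℕ × ℕ × Bool × Bool × Bool => q.2.2.2.2 :=
    Primrec.snd.comp (Primrec.snd.comp (Primrec.snd.comp Primrec.snd))
  have heq : ∀ c, PrimrecPred fun q : ℕ × ℕ × Bool × Bool × Bool => q.2.1.unpair.1 = c :=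
    fun c => Primrec.eq.comp (Primrec.fst.comp (Primrec.unpair.comp hm)) (Primrec.const c)
  have hpred : PrimrecPred fun q : ℕ × ℕ × Bool × Bool × Bool =>
      q.2.1.unpair.2.unpair.1 = q.1 :=
    Primrec.eq.comp (Primrec.fst.comp (Primrec.unpair.comp (Primrec.snd.comp
      (Primrec.unpair.comp hm)))) Primrec.fst
  have hstep : Primrec fun q : ℕ × ℕ × Bool × Bool × Bool =>
      occursStep q.1 q.2.1 q.2.2.1 q.2.2.2.1 q.2.2.2.2 :=
    Primrec.ite (heq 0) hpred.decide (Primrec.ite (heq 1) (Primrec.const false)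
      (Primrec.ite (heq 2) h0 (Primrec.ite (heq 3) (Primrec.or.comp h1 h2) h2)))
  exact Primrec.treeFold hstep

namespace Presentation

open WMSO

variable {i : α → Presentation} {a b x m : α → ℕ} {prev : α → List WMSO}

theorem primrec_letters (hi : Primrec i) : Primrec fun t => (i t).1 := Primrec.fst.comp hi

theorem primrec_states (hi : Primrec i) : Primrec fun t => (i t).2.1 :=
  Primrec.fst.comp (Primrec.snd.comp hi)

theorem primrec_start (hi : Primrec i) : Primrec fun t => (i t).2.2.1 :=
  Primrec.fst.comp (Primrec.snd.comp (Primrec.snd.comp hi))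

theorem primrec_priority (hi : Primrec i) (ha : Primrec a) :
    Primrec fun t => priority (i t) (a t) :=
  (Primrec.list_getD 0).comp
    (Primrec.fst.comp (Primrec.snd.comp (Primrec.snd.comp (Primrec.snd.comp hi)))) ha

theorem primrec_entry (hi : Primrec i) (ha : Primrec a) (hm : Primrec m) :
    Primrec fun t => entry (i t) (a t) (m t) :=
  (Primrec.list_getD 0).comp ((Primrec.list_getD []).comp
    (Primrec.snd.comp (Primrec.snd.comp (Primrec.snd.comp (Primrec.snd.comp hi)))) ha) hm

theorem primrecPred_edge (hi : Primrec i) (ha : Primrec a) (hb : Primrec b) :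
    PrimrecPred fun t => Edge (i t) (a t) (b t) := by
  have h : PrimrecRel fun (m : ℕ) (t : α) => occurs (b t) (entry (i t) (a t) m) = true :=
    Primrec.eq.comp (primrec_occurs.comp (hb.comp Primrec.snd) (primrec_entry
      (hi.comp Primrec.snd) (ha.comp Primrec.snd) Primrec.fst)) (Primrec.const true)
  exact primrecPred_exists_lt h (primrec_two_pow.comp (primrec_letters hi))

theorem primrecPred_reaches (hi : Primrec i) (ha : Primrec a) (hb : Primrec b) :
    PrimrecPred fun t => Reaches (i t) (a t) (b t) := by
  have hbit : ∀ {β : Type} [Primcodable β] {S c : β → ℕ}, Primrec S → Primrec c →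
      PrimrecPred fun t => (S t).testBit (c t) = true :=
    fun hS hc => Primrec.eq.comp (primrec_testBit.comp hS hc) (Primrec.const true)
  have hd : PrimrecRel fun (d : ℕ) (q : ℕ × ℕ × α) => Edge (i q.2.2) q.1 d →
      q.2.1.testBit q.1 = true → q.2.1.testBit d = true := by
    have hq : Primrec fun r : ℕ × ℕ × ℕ × α => r.2.1 := Primrec.fst.comp Primrec.snd
    have hS : Primrec fun r : ℕ × ℕ × ℕ × α => r.2.2.1 :=
      Primrec.fst.comp (Primrec.snd.comp Primrec.snd)
    have ht : Primrec fun r : ℕ × ℕ × ℕ × α => r.2.2.2 :=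
      Primrec.snd.comp (Primrec.snd.comp Primrec.snd)
    exact (primrecPred_edge (hi.comp ht) hq Primrec.fst).imp
      ((hbit hS hq).imp (hbit hS Primrec.fst))
  have hc : PrimrecRel fun (c : ℕ) (q : ℕ × α) => ∀ d < (i q.2).2.1, Edge (i q.2) c d →
      q.1.testBit c = true → q.1.testBit d = true :=
    primrecPred_forall_lt hd (primrec_states (hi.comp (Primrec.snd.comp Primrec.snd)))
  have hS : PrimrecRel fun (S : ℕ) (t : α) => S.testBit (a t) = true →
      (∀ c < (i t).2.1, ∀ d < (i t).2.1, Edge (i t) c d → S.testBit c = true →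
        S.testBit d = true) → S.testBit (b t) = true :=
    (hbit Primrec.fst (ha.comp Primrec.snd)).imp
      ((primrecPred_forall_lt hc (primrec_states (hi.comp Primrec.snd))).imp
        (hbit Primrec.fst (hb.comp Primrec.snd)))
  exact primrecPred_forall_lt hS (primrec_two_pow.comp (primrec_states hi))

theorem primrecPred_together (hi : Primrec i) (ha : Primrec a) (hb : Primrec b) :
    PrimrecPred fun t => Together (i t) (a t) (b t) :=
  (primrecPred_reaches hi ha hb).and (primrecPred_reaches hi hb ha)

theorem primrecPred_odd (hi : Primrec i) (ha : Primrec a) :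
    PrimrecPred fun t => priority (i t) (a t) % 2 = 1 :=
  Primrec.eq.comp (Primrec.nat_mod.comp (primrec_priority hi ha) (Primrec.const 2))
    (Primrec.const 1)

theorem primrec_atom (hi : Primrec i) (ha : Primrec a) (hprev : Primrec prev) (hb : Primrec b)
    (hx : Primrec x) : Primrec fun t => atom (i t) (a t) (prev t) (b t) (x t) := by
  classical
  have hk := primrec_letters hi
  have hv := primrec_var hk hx
  have hsub := primrec_sub.comp hv (primrec_state hk hb)
  have hget : Primrec fun t => (prev t).getD (b t) (top (node (i t).1)) :=
    (Primrec.option_getD.comp (Primrec.list_getElem?.comp hprev hb) (primrec_top hk)).of_eq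
      fun t => by rw [List.getD_eq_getElem?_getD]; rfl
  exact Primrec.ite (primrecPred_together hi ha hb)
    (Primrec.ite (primrecPred_odd hi ha) hsub (primrec_neg.comp hsub))
    (primrec_ex.comp hk (primrec_and.comp (primrec_sub.comp hk hv)
      (primrec_and.comp (primrec_sub.comp hv hk) hget)))

theorem primrec_hasColour {k : α → ℕ} (hk : Primrec k) (hm : Primrec m) :
    Primrec fun t => hasColour (k t) (m t) := by
  have hsub : Primrec fun q : α × ℕ => sub (node (k q.1)) q.2 :=
    primrec_sub.comp (hk.comp Primrec.fst) Primrec.snd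
  have hlit : Primrec₂ fun t p => literal (k t) (m t) p :=
    Primrec.ite (Primrec.eq.comp (primrec_testBit.comp (hm.comp Primrec.fst) Primrec.snd)
      (Primrec.const true)) hsub (primrec_neg.comp hsub)
  exact primrec_bigAnd hk (Primrec.list_map (Primrec.list_range.comp hk) hlit)

theorem primrec_oneStep (hi : Primrec i) (ha : Primrec a) (hprev : Primrec prev)
    (hb : Primrec b) : Primrec fun t => oneStep (i t) (a t) (prev t) (b t) := by
  have hk := primrec_letters hi
  have hi' : Primrec fun q : α × ℕ => i q.1 := hi.comp Primrec.fst
  have hk' := primrec_letters hi'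
  have hat : Primrec fun q : (α × ℕ) × ℕ × ℕ => atom (i q.1.1) (a q.1.1) (prev q.1.1)
      q.2.1 q.2.2 :=
    have h1 : Primrec fun q : (α × ℕ) × ℕ × ℕ => q.1.1 := Primrec.fst.comp Primrec.fst
    primrec_atom (hi.comp h1) (ha.comp h1) (hprev.comp h1) (Primrec.fst.comp Primrec.snd)
      (Primrec.snd.comp Primrec.snd)
  have h : Primrec₂ fun t m => and (hasColour (i t).1 m)
      (translate (i t).1 (atom (i t) (a t) (prev t)) (entry (i t) (b t) m)) :=
    primrec_and.comp (primrec_hasColour hk' Primrec.snd) (primrec_translate hk' hat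
      (primrec_entry hi' (hb.comp Primrec.fst) Primrec.snd))
  exact primrec_bigOr hk
    (Primrec.list_map (Primrec.list_range.comp (primrec_two_pow.comp hk)) h)

theorem primrec_closed (hi : Primrec i) (ha : Primrec a) (hprev : Primrec prev)
    (hb : Primrec b) : Primrec fun t => closed (i t) (a t) (prev t) (b t) := by
  classical
  have hk := primrec_letters hi
  have hstep := primrec_oneStep hi ha hprev hb
  have hbox : Primrec fun t => box (i t).1 := primrec_add_const 4 hk
  exact Primrec.ite (primrecPred_together hi ha hb)
    (primrec_neg.comp (primrec_ex.comp hk (primrec_and.comp (primrec_single hk hk)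
      (primrec_and.comp (primrec_sub.comp hk hbox) (primrec_and.comp
        (Primrec.ite (primrecPred_odd hi ha) hstep (primrec_neg.comp hstep))
        (primrec_neg.comp (primrec_sub.comp hk (primrec_state hk hb))))))))
    (primrec_top hk)

theorem primrec_fixpoint (hi : Primrec i) (ha : Primrec a) (hprev : Primrec prev) :
    Primrec fun t => fixpoint (i t) (a t) (prev t) := by
  have hk := primrec_letters hi
  have hrange := Primrec.list_range.comp (primrec_states hi)
  have hbox : Primrec fun t => box (i t).1 := primrec_add_const 4 hk
  have hst : Primrec₂ fun t b => state (i t).1 b :=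
    primrec_state (hk.comp Primrec.fst) Primrec.snd
  have hcl : Primrec₂ fun t b => closed (i t) (a t) (prev t) b :=
    primrec_closed (hi.comp Primrec.fst) (ha.comp Primrec.fst) (hprev.comp Primrec.fst)
      Primrec.snd
  exact primrec_ex.comp hbox (primrec_and.comp (primrec_sub.comp hk hbox) (primrec_neg.comp
    (primrec_exs (Primrec.list_map hrange hst) (primrec_and.comp
      (primrec_bigAnd hk (Primrec.list_map hrange hcl))
      (primrec_neg.comp (primrec_sub.comp hk (primrec_state hk ha)))))))

theorem primrec_nextLevel : Primrec₂ nextLevel := by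
  have hi : Primrec fun q : (Presentation × List WMSO) × ℕ => q.1.1 :=
    Primrec.fst.comp Primrec.fst
  have hfix := primrec_fixpoint hi Primrec.snd (Primrec.snd.comp Primrec.fst)
  have h : Primrec₂ fun (q : Presentation × List WMSO) (a : ℕ) =>
      if priority q.1 a % 2 = 1 then fixpoint q.1 a q.2 else neg (fixpoint q.1 a q.2) :=
    Primrec.ite (primrecPred_odd hi Primrec.snd) hfix (primrec_neg.comp hfix)
  exact Primrec.list_map (Primrec.list_range.comp (primrec_states Primrec.fst)) h

theorem primrec_formula : Primrec formula := by
  have hi : Primrec fun i : Presentation => i := Primrec.id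
  have hk := primrec_letters hi
  have hlev : Primrec fun i : Presentation => (nextLevel i)^[i.2.1] [] :=
    Primrec.nat_iterate (primrec_states hi) (Primrec.const []) primrec_nextLevel
  have hget : Primrec fun i : Presentation =>
      ((nextLevel i)^[i.2.1] []).getD i.2.2.1 (top (node i.1)) :=
    (Primrec.option_getD.comp (Primrec.list_getElem?.comp hlev (primrec_start hi))
      (primrec_top hk)).of_eq fun t => by rw [List.getD_eq_getElem?_getD]; rfl
  exact primrec_ex.comp hk (primrec_and.comp (primrec_here.comp hk) hget)

end Presentation

end

theorem mainTheorem3 :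
    ∃ F : ℕ × ℕ × ℕ × List ℕ × List (List ℕ) → ℕ, Computable F ∧
      ∀ (k : ℕ) (𝔸 : ParityAutomaton k), ParityAutomaton.IsContinuousWeak.{u} 𝔸 →
        ∃ φ : WMSO, φ.IsOver k ∧ F 𝔸.code = φ.code ∧
          ∀ (T : Type u) (M : LTS k T), 𝔸.Accepts M ↔ φ.TrueIn M :=
  ⟨fun i => (Presentation.formula i).code,
    (Primrec.encode.comp Presentation.primrec_formula).to_comp, fun _ 𝔸 h𝔸 =>
      ⟨Presentation.formula 𝔸.code, ParityAutomaton.isOver_formula, rfl, fun _ _ =>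
        (ParityAutomaton.trueIn_formula_iff h𝔸).symm⟩⟩
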